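/- Let $C$ be an algebraically closed field of characteristic zero, regarded as a differential field with zero derivation. All rings below are commutative unless stated otherwise; a $\delta$-ring is a commutative ring with a derivation $\delta$, and a $\delta$-module over a $\delta$-ring $R$ is an $R$-module with an additive map $\delta$ such that $\delta(rm)=\delta(r)m+r\delta(m)$. Let $R$ be a $\delta$-$C$-algebra and $S$ a $\delta$-$R$-algebra. **Types and objects.** A type $\Phi=(H,I,\{(n_{1i},n_{2i},n_{3i},n_{4i})\}_{i\in I})$ over $R$ consists of a $\delta$-Hopf algebra $H$ over $R$, a set $I$ and a family of elements of $\mathbb N^4$. A $\Phi$-object is a $\delta$-$R$-module $M$ with $\delta$-$R$-linear maps $\Phi_i\colon M^{\otimes n_{1i}}\otimes_R H^{\otimes n_{2i}}\to M^{\otimes n_{3i}}\otimes_R H^{\otimes n_{4i}}$, $i\in I$; morphisms are the $\delta$-$R$-linear maps $f$ that commute with the $\Phi_i$ via $f^{\otimes n_{1i}}\otimes\mathrm{id}$ and $f^{\otimes n_{3i}}\otimes\mathrm{id}$. For a $\delta$-$R$-algebra $T$, extension of scalars $M\mapsto M_T=M\otimes_R T$ takes $\Phi$-objects to $\Phi_T$-objects,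 where $\Phi_T$ is $\Phi$ with $H$ replaced by $H\otimes_R T$. For a $\Phi$-object $M$, $\mathrm{TF}(S/R,M)$ is the set of isomorphism classes of $\Phi$-objects $N$ over $R$ such that $N_S\cong M_S$ as $\Phi_S$-objects. **Setup.** Let $\Gamma$ be a linear algebraic group over $C$ with coordinate Hopf algebra $C[\Gamma]$ (with zero derivation), and let $S/R$ be a $\delta$-$(C[\Gamma]\otimes_C R)$-Hopf–Galois extension. That is: * $S$ is $\delta$-faithfully flat over $R$: a sequence of $\delta$-$R$-modules is exact if and only if it is exact after applying $-\otimes_R S$; * $S$ carries a coassociative counital coaction $\Delta_S\colon S\to S\otimes_C C[\Gamma]$ which is $R$-linear and commutes with the derivations; * the map $S\otimes_R S\to S\otimes_C C[\Gamma]$, $x\otimes y\mapsto(x\otimes1)\Delta_S(y)$, is an isomorphism of $\delta$-algebras. Let $M$ be a $\Phi$-object over $R$, and assume that a linear algebraic group $G$ over $C$ represents the automorphisms of $M_S$: there are group isomorphisms $\mathrm{Aut}^{\delta,\Phi}(M_S\otimes_C D)\cong G(D)$, natural in the commutative $C$-algebra $D$. We identify the two sides. For $\sigma\in\Gamma(C)$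 put $\boldsymbol\sigma=(1\otimes\sigma)\circ\Delta_S\colon S\to S$; write $\boldsymbol\sigma$ also for the induced map $\mathrm{id}_N\otimes\boldsymbol\sigma$ of $N_S$ for any $\delta$-$R$-module $N$. The group $\Gamma(C)$ acts on $G(C)=\mathrm{Aut}^{\delta,\Phi}(M_S)$ by group automorphisms through $\sigma(x)=\boldsymbol\sigma\circ x\circ\boldsymbol\sigma^{-1}$. A 1-cocycle is a morphism of varieties $a\colon\Gamma\to G$ with $a_{\sigma\tau}=a_\sigma\cdot\sigma(a_\tau)$ for all $\sigma,\tau\in\Gamma(C)$; cocycles $a,b$ are equivalent if there is $c\in G(C)$ with $a_\sigma=c\cdot b_\sigma\cdot\sigma(c)^{-1}$ for all $\sigma\in\Gamma(C)$. Let $H^1_\delta(\Gamma,G)$ be the set of equivalence classes of 1-cocycles. **Theorem.** 1. For every $(S/R)$-twisted form $N$ of $M$ and every isomorphism $\varphi\colon N_S\to M_S$ of $\Phi_S$-objects, the assignment $\sigma\mapsto\varphi\circ\boldsymbol\sigma\circ\varphi^{-1}\circ\boldsymbol\sigma^{-1}$ is a 1-cocycle. Its class depends only on the isomorphism class of $N$,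 which gives a well-defined map $\mathcal F\colon\mathrm{TF}(S/R,M)\to H^1_\delta(\Gamma,G)$. 2. For every 1-cocycle $a$, the $\delta$-$R$-module $\mathcal G(a)=\{m\in M_S : a_\sigma(\boldsymbol\sigma(m))=m\text{ for all }\sigma\in\Gamma(C)\}$ has a unique $\Phi$-structure for which scalar multiplication $\mathcal G(a)\otimes_R S\to M_S$ is an isomorphism of $\Phi_S$-objects. The isomorphism class of $\mathcal G(a)$ depends only on the class of $a$, which gives a well-defined map $\mathcal G\colon H^1_\delta(\Gamma,G)\to\mathrm{TF}(S/R,M)$. 3. The maps $\mathcal F$ and $\mathcal G$ are mutually inverse. Hence they give a bijection $\mathrm{TF}(S/R,M)\cong H^1_\delta(\Gamma,G)$. -/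

import Mathlib

open scoped TensorProduct Differential

universe u

noncomputable section

namespace DiffDescent

/-- A differential module over a differential ring. -/
structure DMod (R : Type u) [CommRing R] [Differential R] where
  carrier : Type u
  [addCommGroup : AddCommGroup carrier]
  [module : Module R carrier]
  δ : carrier →+ carrier
  leibniz : ∀ (r : R) (m : carrier), δ (r • m) = r′ • m + r • δ m

namespace DMod

attribute [instance] addCommGroup module

instance (R : Type u) [CommRing R] [Differential R] : CoeSort (DMod R) (Type u) := ⟨carrier⟩

section Basic

variable {R : Type u} [CommRing R] [Differential R]

/-- A linear map of differential modules which commutes with the derivations. -/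
def IsDHom {M N : DMod R} (f : M →ₗ[R] N) : Prop := ∀ m : M, f (M.δ m) = N.δ (f m)

variable (R) in
/-- The differential ring as a differential module over itself. -/
@[reducible] def unit : DMod R where
  carrier := R
  δ := (Differential.deriv : Derivation ℤ R R).toLinearMap.toAddMonoidHom
  leibniz r m := by simp [mul_comm]; ring

/-- A differential `R`-algebra as a differential `R`-module. -/
@[reducible] def ofAlgebra (A : Type u) [CommRing A] [Differential A] [Algebra R A]
    [DifferentialAlgebra R A] : DMod R where
  carrier := A
  δ := (Differential.deriv : Derivation ℤ A A).toLinearMap.toAddMonoidHom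
  leibniz r m := by
    simp [Algebra.smul_def, deriv_algebraMap]; ring

/-- The tensor product, with `δ (m ⊗ n) = δ m ⊗ n + m ⊗ δ n`. -/
@[reducible] def tensor (M N : DMod R) : DMod R where
  carrier := M ⊗[R] N
  δ := TensorProduct.liftAddHom
    { toFun := fun m =>
        { toFun := fun n => M.δ m ⊗ₜ[R] n + m ⊗ₜ[R] N.δ n
          map_zero' := by simp
          map_add' := fun a b => by simp only [map_add, TensorProduct.tmul_add]; abel }
      map_zero' := by ext; simp
      map_add' := fun a b => by
        ext n; simp only [map_add, TensorProduct.add_tmul, AddMonoidHom.coe_mk, ZeroHom.coe_mk,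
          AddMonoidHom.add_apply]; abel }
    (fun r m n => by
      simp only [AddMonoidHom.coe_mk, ZeroHom.coe_mk, M.leibniz, N.leibniz,
        TensorProduct.add_tmul, TensorProduct.tmul_add, TensorProduct.smul_tmul]; abel)
  leibniz r x := by
    induction x using TensorProduct.induction_on with
    | zero => simp
    | add x y hx hy => simp only [smul_add, map_add, hx, hy]; abel
    | tmul m n =>
      simp only [TensorProduct.smul_tmul', TensorProduct.liftAddHom_tmul, AddMonoidHom.coe_mk,
        ZeroHom.coe_mk, M.leibniz, TensorProduct.add_tmul, smul_add]; abel

@[simp] theorem tensor_δ_tmul (M N : DMod R) (m : M) (n : N) :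
    (tensor M N).δ (m ⊗ₜ[R] n) = M.δ m ⊗ₜ[R] n + m ⊗ₜ[R] N.δ n := rfl

/-- Tensor powers. -/
@[reducible] def tpow (M : DMod R) : ℕ → DMod R
  | 0 => unit R
  | n + 1 => tensor M (tpow M n)

/-- `f ⊗ ⋯ ⊗ f`. -/
def tpowMap {M N : DMod R} (f : M →ₗ[R] N) : (n : ℕ) → (tpow M n →ₗ[R] tpow N n)
  | 0 => LinearMap.id
  | n + 1 => TensorProduct.map f (tpowMap f n)

theorem tpowMap_id (M : DMod R) (n : ℕ) :
    tpowMap (LinearMap.id : M →ₗ[R] M) n = LinearMap.id := by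
  induction n with
  | zero => rfl
  | succ n ih => exact (congrArg _ ih).trans TensorProduct.map_id

theorem tpowMap_comp {M N P : DMod R} (g : N →ₗ[R] P) (f : M →ₗ[R] N) (n : ℕ) :
    tpowMap (g ∘ₗ f) n = tpowMap g n ∘ₗ tpowMap f n := by
  induction n with
  | zero => rfl
  | succ n ih => exact (congrArg _ ih).trans (TensorProduct.map_comp ..)

end Basic

section BaseChange

variable {R : Type u} [CommRing R] [Differential R]
variable (T : Type u) [CommRing T] [Differential T] [Algebra R T] [DifferentialAlgebra R T]

/-- Extension of scalars, with `δ (t ⊗ m) = t′ ⊗ m + t ⊗ δ m`. -/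
@[reducible] def baseChange (M : DMod R) : DMod T where
  carrier := T ⊗[R] M
  δ := (tensor (ofAlgebra T) M).δ
  leibniz t x := by
    induction x using TensorProduct.induction_on with
    | zero => simp
    | add x y hx hy => rw [smul_add, map_add, hx, hy, map_add, smul_add, smul_add]; abel
    | tmul s m =>
      rw [TensorProduct.smul_tmul', tensor_δ_tmul, tensor_δ_tmul, smul_add,
        TensorProduct.smul_tmul', TensorProduct.smul_tmul', TensorProduct.smul_tmul']
      simp [TensorProduct.add_tmul, mul_comm s t′, add_assoc, add_left_comm]

@[simp] theorem baseChange_δ_tmul (M : DMod R) (t : T) (m : M) :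
    (baseChange T M).δ (t ⊗ₜ[R] m) = t′ ⊗ₜ[R] m + t ⊗ₜ[R] M.δ m := rfl

/-- `T ⊗ (M ⊗ N) ≃ (T ⊗ M) ⊗ (T ⊗ N)`. -/
def baseChangeTensor (M N : DMod R) :
    baseChange T (tensor M N) ≃ₗ[T] tensor (baseChange T M) (baseChange T N) :=
  TensorProduct.AlgebraTensorModule.distribBaseChange R T M N

/-- `T ⊗ M^{⊗ n} ≃ (T ⊗ M)^{⊗ n}`. -/
def baseChangePow (M : DMod R) : (n : ℕ) → (baseChange T (tpow M n) ≃ₗ[T] tpow (baseChange T M) n)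
  | 0 => TensorProduct.AlgebraTensorModule.rid R T T
  | n + 1 => (baseChangeTensor T M (tpow M n)).trans
      (TensorProduct.congr (LinearEquiv.refl T _) (baseChangePow M n))


theorem isDHom_comp {R : Type u} [CommRing R] [Differential R] {M N P : DMod R}
    {g : N →ₗ[R] P} {f : M →ₗ[R] N} (hg : IsDHom g) (hf : IsDHom f) : IsDHom (g ∘ₗ f) :=
  fun m => by rw [LinearMap.comp_apply, hf, hg, LinearMap.comp_apply]

theorem isDHom_symm {R : Type u} [CommRing R] [Differential R] {M N : DMod R}
    {e : M ≃ₗ[R] N} (he : IsDHom e.toLinearMap) : IsDHom e.symm.toLinearMap := fun n => by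
  have := he (e.symm n)
  simp only [LinearEquiv.coe_coe, LinearEquiv.apply_symm_apply] at this ⊢
  rw [← this, LinearEquiv.symm_apply_apply]

theorem isDHom_tensorMap {R : Type u} [CommRing R] [Differential R] {M N M' N' : DMod R}
    {f : M →ₗ[R] M'} {g : N →ₗ[R] N'} (hf : IsDHom f) (hg : IsDHom g) :
    IsDHom (M := tensor M N) (N := tensor M' N') (TensorProduct.map f g) := fun x => by
  induction x using TensorProduct.induction_on with
  | zero => simp
  | add x y hx hy => rw [map_add, map_add, hx, hy, map_add, map_add]
  | tmul m n =>
    rw [tensor_δ_tmul, map_add, TensorProduct.map_tmul, TensorProduct.map_tmul,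
      TensorProduct.map_tmul, tensor_δ_tmul, hf, hg]

theorem isDHom_baseChangeTensor (M N : DMod R) :
    IsDHom (baseChangeTensor T M N).toLinearMap := fun x => by
  induction x using TensorProduct.induction_on with
  | zero => simp
  | add x y hx hy => rw [map_add, map_add, hx, hy, map_add, map_add]
  | tmul t y =>
    induction y using TensorProduct.induction_on with
    | zero => simp
    | add x y hx hy => rw [TensorProduct.tmul_add, map_add, map_add, hx, hy, map_add, map_add]
    | tmul m n =>
      have h : ∀ (t : T) (m : M) (n : N), baseChangeTensor T M N (t ⊗ₜ[R] (m ⊗ₜ[R] n)) =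
        (t ⊗ₜ[R] m) ⊗ₜ[T] (1 ⊗ₜ[R] n) := fun t m n => rfl
      rw [baseChange_δ_tmul, map_add, tensor_δ_tmul, TensorProduct.tmul_add, map_add]
      simp only [LinearEquiv.coe_coe, h]
      simp [TensorProduct.add_tmul, add_assoc]

theorem isDHom_baseChangePow (M : DMod R) (n : ℕ) :
    IsDHom (baseChangePow T M n).toLinearMap := by
  induction n with
  | zero =>
    intro x
    induction x using TensorProduct.induction_on with
    | zero => simp
    | add x y hx hy => rw [map_add, map_add, hx, hy, map_add, map_add]
    | tmul t r =>
      have h : ∀ (t : T) (r : R), baseChangePow T M 0 (t ⊗ₜ[R] r) = r • t := fun t r => rfl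
      rw [baseChange_δ_tmul, map_add]
      simp only [LinearEquiv.coe_coe, h]
      simp [Algebra.smul_def, deriv_algebraMap, mul_comm, add_comm]
  | succ n ih =>
    exact isDHom_comp (isDHom_tensorMap (f := LinearMap.id) (fun _ => rfl) ih)
      (isDHom_baseChangeTensor T M (tpow M n))

theorem isDHom_baseChange {M N : DMod R} {f : M →ₗ[R] N} (hf : IsDHom f) :
    IsDHom (M := baseChange T M) (N := baseChange T N) (f.baseChange T) := fun x => by
  induction x using TensorProduct.induction_on with
  | zero => simp
  | add x y hx hy => rw [map_add, map_add, hx, hy, map_add, map_add]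
  | tmul t m =>
    rw [baseChange_δ_tmul, map_add, LinearMap.baseChange_tmul, LinearMap.baseChange_tmul,
      LinearMap.baseChange_tmul, hf m, baseChange_δ_tmul]

/-- `T ⊗ (M^{⊗ a} ⊗ N^{⊗ b}) ≃ (T ⊗ M)^{⊗ a} ⊗ (T ⊗ N)^{⊗ b}`. -/
def baseChangeMixed (M N : DMod R) (a b : ℕ) :
    baseChange T (tensor (tpow M a) (tpow N b)) ≃ₗ[T]
      tensor (tpow (baseChange T M) a) (tpow (baseChange T N) b) :=
  (baseChangeTensor T (tpow M a) (tpow N b)).trans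
    (TensorProduct.congr (baseChangePow T M a) (baseChangePow T N b))

theorem isDHom_baseChangeMixed (M N : DMod R) (a b : ℕ) :
    IsDHom (baseChangeMixed T M N a b).toLinearMap :=
  isDHom_comp (isDHom_tensorMap (isDHom_baseChangePow T M a) (isDHom_baseChangePow T N b))
    (isDHom_baseChangeTensor T (tpow M a) (tpow N b))

end BaseChange
end DMod

section Phi

/-- The derivations of a Hopf algebra `H` over a differential ring are compatible with all the
structure maps (those of the algebra structure being covered by `DifferentialAlgebra R H`). -/
class DifferentialHopfAlgebra (R H : Type u) [CommRing R] [Differential R] [CommRing H]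
    [Differential H] [HopfAlgebra R H] : Prop extends DifferentialAlgebra R H where
  comul_deriv : ∀ h : H, Coalgebra.comul (R := R) (Differential.deriv h) =
    (DMod.tensor (DMod.ofAlgebra H) (DMod.ofAlgebra H)).δ (Coalgebra.comul (R := R) h)
  counit_deriv : ∀ h : H,
    Coalgebra.counit (R := R) (Differential.deriv h) =
      Differential.deriv (Coalgebra.counit (R := R) h)
  antipode_deriv : ∀ h : H,
    HopfAlgebra.antipode R (Differential.deriv h) = Differential.deriv (HopfAlgebra.antipode R h)

/-- A type `Φ = (H, I, (n₁ᵢ, n₂ᵢ, n₃ᵢ, n₄ᵢ)_{i ∈ I})` over a differential ring. -/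
structure PhiType (R : Type u) [CommRing R] [Differential R] where
  H : Type u
  [commRing : CommRing H]
  [differential : Differential H]
  [hopf : HopfAlgebra R H]
  [dhopf : DifferentialHopfAlgebra R H]
  I : Type u
  n₁ : I → ℕ
  n₂ : I → ℕ
  n₃ : I → ℕ
  n₄ : I → ℕ

attribute [instance] PhiType.commRing PhiType.differential PhiType.hopf PhiType.dhopf

/-- The part of a type that enters the definition of its objects and morphisms: of the Hopf algebra
only the underlying differential module matters. -/
structure PhiShape (R : Type u) [CommRing R] [Differential R] where
  K : DMod R
  I : Type u
  n₁ : I → ℕ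
  n₂ : I → ℕ
  n₃ : I → ℕ
  n₄ : I → ℕ

variable {R : Type u} [CommRing R] [Differential R]

/-- The shape of a type. -/
@[reducible] def PhiType.shape (Φ : PhiType R) : PhiShape R where
  K := DMod.ofAlgebra Φ.H
  I := Φ.I
  n₁ := Φ.n₁
  n₂ := Φ.n₂
  n₃ := Φ.n₃
  n₄ := Φ.n₄

/-- Extension of scalars of a type: `H` is replaced by `T ⊗ H`. -/
@[reducible] def PhiShape.baseChange (T : Type u) [CommRing T] [Differential T] [Algebra R T]
    [DifferentialAlgebra R T] (Φ : PhiShape R) : PhiShape T where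
  K := DMod.baseChange T Φ.K
  I := Φ.I
  n₁ := Φ.n₁
  n₂ := Φ.n₂
  n₃ := Φ.n₃
  n₄ := Φ.n₄

/-- The source `M^{⊗ n₁ᵢ} ⊗ H^{⊗ n₂ᵢ}` of the `i`-th operation. -/
@[reducible] def PhiShape.src (Φ : PhiShape R) (M : DMod R) (i : Φ.I) : DMod R :=
  DMod.tensor (DMod.tpow M (Φ.n₁ i)) (DMod.tpow Φ.K (Φ.n₂ i))

/-- The target `M^{⊗ n₃ᵢ} ⊗ H^{⊗ n₄ᵢ}` of the `i`-th operation. -/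
@[reducible] def PhiShape.tgt (Φ : PhiShape R) (M : DMod R) (i : Φ.I) : DMod R :=
  DMod.tensor (DMod.tpow M (Φ.n₃ i)) (DMod.tpow Φ.K (Φ.n₄ i))

/-- The map `f^{⊗ n₁ᵢ} ⊗ id`. -/
def PhiShape.srcMap (Φ : PhiShape R) {M N : DMod R} (f : M →ₗ[R] N) (i : Φ.I) :
    Φ.src M i →ₗ[R] Φ.src N i :=
  TensorProduct.map (DMod.tpowMap f (Φ.n₁ i)) LinearMap.id

/-- The map `f^{⊗ n₃ᵢ} ⊗ id`. -/
def PhiShape.tgtMap (Φ : PhiShape R) {M N : DMod R} (f : M →ₗ[R] N) (i : Φ.I) :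
    Φ.tgt M i →ₗ[R] Φ.tgt N i :=
  TensorProduct.map (DMod.tpowMap f (Φ.n₃ i)) LinearMap.id

/-- A `Φ`-structure on a differential module. -/
structure PhiStruct (Φ : PhiShape R) (M : DMod R) where
  op : ∀ i : Φ.I, Φ.src M i →ₗ[R] Φ.tgt M i
  op_δ : ∀ i : Φ.I, DMod.IsDHom (op i)

/-- A `Φ`-object. -/
structure PhiObj (Φ : PhiShape R) where
  mod : DMod R
  str : PhiStruct Φ mod

namespace PhiObj

/-- Extension of scalars of a `Φ`-object: the operations are `id_T ⊗ Φᵢ`, read through the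
canonical isomorphisms of `T ⊗ (M^{⊗ a} ⊗ H^{⊗ b})` with `(T ⊗ M)^{⊗ a} ⊗ (T ⊗ H)^{⊗ b}`. -/
@[reducible] def baseChange (T : Type u) [CommRing T] [Differential T] [Algebra R T]
    [DifferentialAlgebra R T] {Φ : PhiShape R} (M : PhiObj Φ) : PhiObj (Φ.baseChange T) where
  mod := DMod.baseChange T M.mod
  str :=
    { op := fun i => (DMod.baseChangeMixed T M.mod Φ.K (Φ.n₃ i) (Φ.n₄ i)).toLinearMap ∘ₗ
        (M.str.op i).baseChange T ∘ₗ
          (DMod.baseChangeMixed T M.mod Φ.K (Φ.n₁ i) (Φ.n₂ i)).symm.toLinearMap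
      op_δ := fun i => DMod.isDHom_comp (DMod.isDHom_baseChangeMixed T _ _ _ _)
        (DMod.isDHom_comp (DMod.isDHom_baseChange T (M.str.op_δ i))
          (DMod.isDHom_symm (DMod.isDHom_baseChangeMixed T _ _ _ _))) }

/-- Morphisms of `Φ`-objects. -/
def IsHom {Φ : PhiShape R} {M N : PhiObj Φ} (f : M.mod →ₗ[R] N.mod) : Prop :=
  DMod.IsDHom f ∧ ∀ i : Φ.I, N.str.op i ∘ₗ Φ.srcMap f i = Φ.tgtMap f i ∘ₗ M.str.op i

theorem isHom_id {Φ : PhiShape R} (M : PhiObj Φ) :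
    IsHom (M := M) (N := M) LinearMap.id := by
  refine ⟨fun _ => rfl, fun i => ?_⟩
  simp only [PhiShape.srcMap, PhiShape.tgtMap, DMod.tpowMap_id, TensorProduct.map_id]
  rfl

theorem isHom_comp {Φ : PhiShape R} {M N P : PhiObj Φ} {g : N.mod →ₗ[R] P.mod}
    {f : M.mod →ₗ[R] N.mod} (hg : IsHom g) (hf : IsHom f) :
    IsHom (M := M) (N := P) (g ∘ₗ f) := by
  refine ⟨DMod.isDHom_comp hg.1 hf.1, fun i => ?_⟩
  have h1 : Φ.srcMap (g ∘ₗ f) i = Φ.srcMap g i ∘ₗ Φ.srcMap f i := by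
    simp only [PhiShape.srcMap, DMod.tpowMap_comp, ← TensorProduct.map_comp, LinearMap.comp_id]
  have h2 : Φ.tgtMap (g ∘ₗ f) i = Φ.tgtMap g i ∘ₗ Φ.tgtMap f i := by
    simp only [PhiShape.tgtMap, DMod.tpowMap_comp, ← TensorProduct.map_comp, LinearMap.comp_id]
  rw [h1, h2, ← LinearMap.comp_assoc, hg.2, LinearMap.comp_assoc, hf.2, LinearMap.comp_assoc]

theorem isHom_symm {Φ : PhiShape R} {M N : PhiObj Φ} {e : M.mod ≃ₗ[R] N.mod}
    (he : IsHom e.toLinearMap) : IsHom (M := N) (N := M) e.symm.toLinearMap := by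
  refine ⟨DMod.isDHom_symm he.1, fun i => ?_⟩
  have h1 : Φ.srcMap e.toLinearMap i ∘ₗ Φ.srcMap e.symm.toLinearMap i = LinearMap.id := by
    simp only [PhiShape.srcMap, ← TensorProduct.map_comp, ← DMod.tpowMap_comp,
      LinearEquiv.comp_symm, DMod.tpowMap_id, LinearMap.comp_id, TensorProduct.map_id]
  have h2 : Φ.tgtMap e.symm.toLinearMap i ∘ₗ Φ.tgtMap e.toLinearMap i = LinearMap.id := by
    simp only [PhiShape.tgtMap, ← TensorProduct.map_comp, ← DMod.tpowMap_comp,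
      LinearEquiv.symm_comp, DMod.tpowMap_id, LinearMap.comp_id, TensorProduct.map_id]
  calc M.str.op i ∘ₗ Φ.srcMap e.symm.toLinearMap i
      = (Φ.tgtMap e.symm.toLinearMap i ∘ₗ Φ.tgtMap e.toLinearMap i) ∘ₗ M.str.op i ∘ₗ
          Φ.srcMap e.symm.toLinearMap i := by rw [h2]; rfl
    _ = Φ.tgtMap e.symm.toLinearMap i ∘ₗ (Φ.tgtMap e.toLinearMap i ∘ₗ M.str.op i) ∘ₗ
          Φ.srcMap e.symm.toLinearMap i := rfl
    _ = Φ.tgtMap e.symm.toLinearMap i ∘ₗ N.str.op i ∘ₗ (Φ.srcMap e.toLinearMap i ∘ₗ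
          Φ.srcMap e.symm.toLinearMap i) := by rw [← he.2]; rfl
    _ = _ := by rw [h1]; rfl

/-- Isomorphisms of `Φ`-objects. -/
structure Iso {Φ : PhiShape R} (M N : PhiObj Φ) where
  toEquiv : M.mod ≃ₗ[R] N.mod
  isHom : IsHom toEquiv.toLinearMap

/-- The automorphism group of a `Φ`-object (multiplication is composition). -/
def Aut {Φ : PhiShape R} (M : PhiObj Φ) : Subgroup (M.mod ≃ₗ[R] M.mod) where
  carrier := {e | IsHom (M := M) (N := M) e.toLinearMap}
  mul_mem' ha hb := isHom_comp ha hb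
  one_mem' := isHom_id M
  inv_mem' ha := isHom_symm ha

/-- Isomorphism is an equivalence relation on `Φ`-objects. -/
def isoSetoid (Φ : PhiShape R) : Setoid (PhiObj Φ) where
  r M N := Nonempty (Iso M N)
  iseqv :=
    { refl := fun M => ⟨⟨LinearEquiv.refl R _, isHom_id M⟩⟩
      symm := fun ⟨e⟩ => ⟨⟨e.toEquiv.symm, isHom_symm e.isHom⟩⟩
      trans := fun ⟨e⟩ ⟨f⟩ => ⟨⟨e.toEquiv.trans f.toEquiv, isHom_comp f.isHom e.isHom⟩⟩ }

end PhiObj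

section TwistedForms

variable (S : Type u) [CommRing S] [Differential S] [Algebra R S] [DifferentialAlgebra R S]

/-- `N` is an `(S/R)`-twisted form of `M`. -/
def IsTwistedForm {Φ : PhiShape R} (M N : PhiObj Φ) : Prop :=
  Nonempty (PhiObj.Iso (N.baseChange S) (M.baseChange S))

/-- The set `TF(S/R, M)` of isomorphism classes of `(S/R)`-twisted forms of `M`. -/
def TF {Φ : PhiShape R} (M : PhiObj Φ) : Type (u + 1) :=
  Quotient ((PhiObj.isoSetoid Φ).comap (Subtype.val : {N // IsTwistedForm S M N} → PhiObj Φ))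

/-- The class of a twisted form. -/
def TF.mk {Φ : PhiShape R} {M : PhiObj Φ} (N : PhiObj Φ) (h : IsTwistedForm S M N) : TF S M :=
  Quotient.mk _ ⟨N, h⟩

end TwistedForms
end Phi

section Constants

/-- The elements of `C` are constants of the differential ring `S`. -/
class IsConstantAlgebra (C S : Type u) [CommRing C] [CommRing S] [Differential S]
    [Algebra C S] : Prop where
  deriv_algebraMap_eq_zero : ∀ c : C, Differential.deriv (algebraMap C S c) = 0

variable (C S : Type u) [CommRing C] [CommRing S] [Differential S] [Algebra C S]
  [IsConstantAlgebra C S]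

/-- The derivation of `S` as a `C`-linear map. -/
def derivLinear : S →ₗ[C] S where
  toFun s := Differential.deriv s
  map_add' := map_add _
  map_smul' c s := by
    simp [Algebra.smul_def, IsConstantAlgebra.deriv_algebraMap_eq_zero]

variable (D : Type u) [CommRing D] [Algebra C D]

/-- The derivation `δ ⊗ id_D` on `S ⊗_C D`: the elements of `D` are constants. -/
instance tensorDifferential : Differential (S ⊗[C] D) where
  deriv := Derivation.mk'
    ((derivLinear C S).rTensor D).toAddMonoidHom.toIntLinearMap (fun x y => by
      induction x using TensorProduct.induction_on with
      | zero => simp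
      | add x₁ x₂ h₁ h₂ => simp only [add_mul, map_add, h₁, h₂, smul_eq_mul, mul_add]; abel
      | tmul s d =>
        induction y using TensorProduct.induction_on with
        | zero => simp
        | add y₁ y₂ h₁ h₂ => simp only [add_mul, map_add, h₁, h₂, smul_eq_mul, mul_add]; abel
        | tmul s' d' =>
          simp [derivLinear, TensorProduct.add_tmul, mul_comm])

@[simp] theorem tensorDifferential_tmul (s : S) (d : D) :
    Differential.deriv (s ⊗ₜ[C] d) = Differential.deriv s ⊗ₜ[C] d := rfl

variable {R : Type u} [CommRing R] [Differential R] [Algebra C R] [Algebra R S]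
  [IsScalarTower C R S] [DifferentialAlgebra R S]

instance : DifferentialAlgebra R (S ⊗[C] D) where
  deriv_algebraMap r := by
    change Differential.deriv (algebraMap R S r ⊗ₜ[C] (1 : D)) = algebraMap R S _ ⊗ₜ[C] (1 : D)
    rw [tensorDifferential_tmul, deriv_algebraMap]

end Constants

section HopfGalois

/-- Differential faithful flatness: a sequence of differential `R`-modules is exact if and only if
it is exact after extension of scalars to `S`. -/
def IsDiffFaithfullyFlat (R S : Type u) [CommRing R] [Differential R] [CommRing S]
    [Algebra R S] : Prop :=
  ∀ (N₁ N₂ N₃ : DMod R) (f : N₁ →ₗ[R] N₂) (g : N₂ →ₗ[R] N₃), DMod.IsDHom f → DMod.IsDHom g →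
    (Function.Exact f g ↔ Function.Exact (f.baseChange S) (g.baseChange S))

/-- `A` is the coordinate Hopf algebra of a linear algebraic group over `C`. -/
class IsLinearAlgebraicGroup (C A : Type u) [Field C] [CommRing A] [HopfAlgebra C A] : Prop where
  finiteType : Algebra.FiniteType C A
  reduced : IsReduced A

/-- The group of `D`-points of the affine group scheme with coordinate Hopf algebra `A`. -/
abbrev Points (C A D : Type u) [Field C] [CommRing A] [HopfAlgebra C A] [CommRing D]
    [Algebra C D] : Type u := WithConv (A →ₐ[C] D)

variable (C A R S : Type u) [Field C] [CommRing A] [HopfAlgebra C A]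
  [CommRing R] [Differential R] [Algebra C R]
  [CommRing S] [Differential S] [Algebra C S] [IsConstantAlgebra C S]
  [Algebra R S] [IsScalarTower C R S] [DifferentialAlgebra R S]

/-- The structure of a differential `(A ⊗_C R)`-Hopf-Galois extension on `S/R`, for a Hopf algebra
`A` over the field of constants `C`. The target `S ⊗_R (A ⊗_C R)` of the coaction is identified
with `S ⊗_C A`. The coaction is an algebra map because `x ⊗ y ↦ (x ⊗ 1) Δ(y)` is one. -/
structure HopfGalois where
  coact : S →ₐ[R] S ⊗[C] A
  coassoc : ∀ s : S, TensorProduct.assoc C S A A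
      ((coact.toLinearMap.restrictScalars C).rTensor A (coact s)) =
    (Coalgebra.comul (R := C) (A := A)).lTensor S (coact s)
  counit : ∀ s : S, (Coalgebra.counit (R := C) (A := A)).lTensor S (coact s) = s ⊗ₜ[C] (1 : C)
  coact_deriv : ∀ s : S, coact (Differential.deriv s) = Differential.deriv (coact s)
  faithfullyFlat : IsDiffFaithfullyFlat R S
  can_bijective : Function.Bijective
    (Algebra.TensorProduct.productMap
      (Algebra.TensorProduct.includeLeft : S →ₐ[R] S ⊗[C] A) coact)

variable {C A R S}

/-- The automorphism `(1 ⊗ σ) ∘ Δ_S` of `S` given by a point `σ` of the group. -/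
def HopfGalois.act (X : HopfGalois C A R S) (σ : Points C A C) : S →ₐ[R] S :=
  ((Algebra.TensorProduct.rid C R S : S ⊗[C] C ≃ₐ[R] S) : S ⊗[C] C →ₐ[R] S).comp
    ((Algebra.TensorProduct.map (AlgHom.id R S) σ.ofConv).comp X.coact)

/-- The action `𝛔` of a point `σ` of the group on `S ⊗_R N`. -/
def HopfGalois.actOn (X : HopfGalois C A R S) (σ : Points C A C) (N : DMod R) :
    DMod.baseChange S N →ₗ[R] DMod.baseChange S N :=
  (X.act σ).toLinearMap.rTensor N

theorem HopfGalois.act_deriv (X : HopfGalois C A R S) (σ : Points C A C) (s : S) :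
    X.act σ (Differential.deriv s) = Differential.deriv (X.act σ s) := by
  have h : ∀ x : S ⊗[C] A,
      Algebra.TensorProduct.rid C R S (Algebra.TensorProduct.map (AlgHom.id R S) σ.ofConv
        (Differential.deriv x)) =
      Differential.deriv (Algebra.TensorProduct.rid C R S
        (Algebra.TensorProduct.map (AlgHom.id R S) σ.ofConv x)) := fun x => by
    induction x using TensorProduct.induction_on with
    | zero => simp
    | add x y hx hy => simp only [map_add, hx, hy]
    | tmul s a =>
      have := (derivLinear C S).map_smul (σ.ofConv a) s
      exact this.symm
  change Algebra.TensorProduct.rid C R S (Algebra.TensorProduct.map (AlgHom.id R S) σ.ofConv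
    (X.coact (Differential.deriv s))) = _
  rw [X.coact_deriv, h]
  rfl

theorem HopfGalois.actOn_δ (X : HopfGalois C A R S) (σ : Points C A C) (N : DMod R)
    (x : DMod.baseChange S N) :
    X.actOn σ N ((DMod.baseChange S N).δ x) = (DMod.baseChange S N).δ (X.actOn σ N x) := by
  induction x using TensorProduct.induction_on with
  | zero => simp
  | add x y hx hy => rw [map_add, map_add, hx, hy, map_add, map_add]
  | tmul s n =>
    have h : ∀ (s : S) (n : N), X.actOn σ N (s ⊗ₜ[R] n) = X.act σ s ⊗ₜ[R] n := fun _ _ => rfl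
    rw [DMod.baseChange_δ_tmul, map_add, h, h, h, DMod.baseChange_δ_tmul, X.act_deriv]

end HopfGalois

section Representability

variable {C : Type u} [Field C] {R S : Type u} [CommRing R] [Differential R] [Algebra C R]
  [CommRing S] [Differential S] [Algebra C S] [IsConstantAlgebra C S]
  [Algebra R S] [IsScalarTower C R S] [DifferentialAlgebra R S]

variable (C S) in
/-- The map `M_S ⊗_C D → M_S ⊗_C D'` given by `g : D → D'`; here `M_S ⊗_C D` is written as
`(S ⊗_C D) ⊗_R M`. -/
def scalarMap (N : DMod R) {D D' : Type u} [CommRing D] [Algebra C D] [CommRing D'] [Algebra C D']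
    (g : D →ₐ[C] D') :
    DMod.baseChange (S ⊗[C] D) N →ₗ[R] DMod.baseChange (S ⊗[C] D') N :=
  (Algebra.TensorProduct.map (AlgHom.id R S) g).toLinearMap.rTensor N

variable (C S) in
/-- The canonical isomorphism `M_S ⊗_C C ≃ M_S`. -/
def scalarRid (N : DMod R) :
    DMod.baseChange (S ⊗[C] C) N ≃ₗ[R] DMod.baseChange S N :=
  (Algebra.TensorProduct.rid C R S).toLinearEquiv.rTensor N

variable (C S) in
/-- The functor `D ↦ Aut^{δ,Φ}(M_S ⊗_C D)` on commutative `C`-algebras is represented by the group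
with coordinate Hopf algebra `B`: isomorphisms of groups `G(D) ≅ Aut^{δ,Φ}(M_S ⊗_C D)`, natural
in `D`. -/
structure AutRep (B : Type u) [CommRing B] [HopfAlgebra C B] {Φ : PhiShape R}
    (M : PhiObj Φ) where
  iso : ∀ (D : Type u) [CommRing D] [Algebra C D],
    Points C B D ≃* PhiObj.Aut (M.baseChange (S ⊗[C] D))
  natural : ∀ (D D' : Type u) [CommRing D] [Algebra C D] [CommRing D'] [Algebra C D']
    (g : D →ₐ[C] D') (x : Points C B D) (m : DMod.baseChange (S ⊗[C] D) M.mod),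
    (iso D' (WithConv.toConv (g.comp x.ofConv))).1 (scalarMap C S M.mod g m) =
      scalarMap C S M.mod g ((iso D x).1 m)

variable {B : Type u} [CommRing B] [HopfAlgebra C B] {Φ : PhiShape R} {M : PhiObj Φ}

/-- The automorphism of `M_S` given by a `C`-point of the representing group. -/
def AutRep.point (ρ : AutRep C S B M) (x : Points C B C) :
    DMod.baseChange S M.mod →ₗ[R] DMod.baseChange S M.mod :=
  (scalarRid C S M.mod).toLinearMap ∘ₗ ((ρ.iso C x).1.toLinearMap.restrictScalars R) ∘ₗ
    (scalarRid C S M.mod).symm.toLinearMap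

theorem scalarRid_δ (N : DMod R) (x : DMod.baseChange (S ⊗[C] C) N) :
    scalarRid C S N ((DMod.baseChange (S ⊗[C] C) N).δ x) =
      (DMod.baseChange S N).δ (scalarRid C S N x) := by
  have h : ∀ t : S ⊗[C] C, Algebra.TensorProduct.rid C R S (Differential.deriv t) =
      Differential.deriv (Algebra.TensorProduct.rid C R S t) := fun t => by
    induction t using TensorProduct.induction_on with
    | zero => simp
    | add x y hx hy => simp only [map_add, hx, hy]
    | tmul s c => exact ((derivLinear C S).map_smul c s).symm
  have h' : ∀ (t : S ⊗[C] C) (n : N),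
      scalarRid C S N (t ⊗ₜ[R] n) = Algebra.TensorProduct.rid C R S t ⊗ₜ[R] n := fun _ _ => rfl
  induction x using TensorProduct.induction_on with
  | zero => simp
  | add x y hx hy => rw [map_add, map_add, hx, hy, map_add, map_add]
  | tmul t n => rw [DMod.baseChange_δ_tmul, map_add, h', h', h', DMod.baseChange_δ_tmul, h]

theorem AutRep.point_δ (ρ : AutRep C S B M) (x : Points C B C)
    (m : DMod.baseChange S M.mod) :
    ρ.point x ((DMod.baseChange S M.mod).δ m) = (DMod.baseChange S M.mod).δ (ρ.point x m) := by
  obtain ⟨m, rfl⟩ := (scalarRid C S M.mod).surjective m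
  have h : ∀ m, ρ.point x (scalarRid C S M.mod m) = scalarRid C S M.mod ((ρ.iso C x).1 m) :=
    fun m => by
      change scalarRid C S M.mod ((ρ.iso C x).1 ((scalarRid C S M.mod).symm _)) = _
      rw [LinearEquiv.symm_apply_apply]
  have h2 : (ρ.iso C x).1 ((DMod.baseChange (S ⊗[C] C) M.mod).δ m) =
      (DMod.baseChange (S ⊗[C] C) M.mod).δ ((ρ.iso C x).1 m) := (ρ.iso C x).2.1 m
  rw [← scalarRid_δ, h, h2, scalarRid_δ, h]

end Representability

section Cohomology

variable {C A B : Type u} [Field C] [CommRing A] [HopfAlgebra C A] [CommRing B] [HopfAlgebra C B]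

/-- A 1-cocycle of `Γ = Spec A` with values in `G = Spec B`, for an action of `Γ(C)` on `G(C)`:
a morphism of varieties `Γ → G` with `a_{στ} = a_σ · σ(a_τ)`. -/
structure Cocycle (act : Points C A C →* MulAut (Points C B C)) where
  toFun : Points C A C → Points C B C
  morphism : ∃ f : B →ₐ[C] A, ∀ σ, toFun σ = WithConv.toConv (σ.ofConv.comp f)
  cocycle : ∀ σ τ, toFun (σ * τ) = toFun σ * act σ (toFun τ)

/-- Equivalence of 1-cocycles: `a_σ = c · b_σ · σ(c)⁻¹` for some `c ∈ G(C)`. -/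
def cocycleSetoid (act : Points C A C →* MulAut (Points C B C)) : Setoid (Cocycle act) where
  r a b := ∃ c : Points C B C, ∀ σ, a.toFun σ = c * b.toFun σ * (act σ c)⁻¹
  iseqv :=
    { refl := fun a => ⟨1, fun σ => by simp⟩
      symm := fun ⟨c, h⟩ => ⟨c⁻¹, fun σ => by rw [h]; simp [mul_assoc]⟩
      trans := fun ⟨c, h⟩ ⟨d, k⟩ => ⟨c * d, fun σ => by rw [h, k]; simp [mul_assoc]⟩ }

/-- The cohomology set `H¹_δ(Γ, G)`. -/
def H1 (act : Points C A C →* MulAut (Points C B C)) : Type u := Quotient (cocycleSetoid act)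

/-- The class of a cocycle. -/
def H1.mk {act : Points C A C →* MulAut (Points C B C)} (a : Cocycle act) : H1 act :=
  Quotient.mk _ a

end Cohomology

section Correspondence

variable {C A B : Type u} [Field C] [CommRing A] [HopfAlgebra C A] [CommRing B] [HopfAlgebra C B]
  {R S : Type u} [CommRing R] [Differential R] [Algebra C R]
  [CommRing S] [Differential S] [Algebra C S] [IsConstantAlgebra C S]
  [Algebra R S] [IsScalarTower C R S] [DifferentialAlgebra R S]
  {Φ : PhiShape R} {M : PhiObj Φ}

/-- The action of `Γ(C)` on `G(C)` is the conjugation action `σ(x) = 𝛔 ∘ x ∘ 𝛔⁻¹` inside the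
transformations of `M_S`. -/
def IsConjugationAction (X : HopfGalois C A R S) (ρ : AutRep C S B M)
    (act : Points C A C →* MulAut (Points C B C)) : Prop :=
  ∀ (σ : Points C A C) (x : Points C B C),
    ρ.point (act σ x) = X.actOn σ M.mod ∘ₗ ρ.point x ∘ₗ X.actOn σ⁻¹ M.mod

/-- The cocycle `a` is given by `a_σ = φ ∘ 𝛔 ∘ φ⁻¹ ∘ 𝛔⁻¹`, for `φ : N_S ≅ M_S`. -/
def IsCocycleOf (X : HopfGalois C A R S) (ρ : AutRep C S B M)
    {act : Points C A C →* MulAut (Points C B C)} {N : PhiObj Φ}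
    (φ : PhiObj.Iso (N.baseChange S) (M.baseChange S)) (a : Cocycle act) : Prop :=
  ∀ (σ : Points C A C) (m : DMod.baseChange S M.mod),
    ρ.point (a.toFun σ) m =
      φ.toEquiv (X.actOn σ N.mod (φ.toEquiv.symm (X.actOn σ⁻¹ M.mod m)))

/-- The differential `R`-module `{m ∈ M_S | a_σ (𝛔 m) = m for all σ ∈ Γ(C)}`. -/
def fixedSubmodule (X : HopfGalois C A R S) (ρ : AutRep C S B M)
    (a : Points C A C → Points C B C) : Submodule R (DMod.baseChange S M.mod) where
  carrier := {m | ∀ σ, ρ.point (a σ) (X.actOn σ M.mod m) = m}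
  add_mem' hx hy σ := by rw [map_add, map_add, hx σ, hy σ]
  zero_mem' σ := by rw [map_zero, map_zero]
  smul_mem' r x hx σ := by rw [map_smul, map_smul, hx σ]

/-- The fixed submodule with the derivation of `M_S`. -/
def fixedModule (X : HopfGalois C A R S) (ρ : AutRep C S B M)
    (a : Points C A C → Points C B C) : DMod R where
  carrier := fixedSubmodule X ρ a
  δ :=
    { toFun := fun m => ⟨(DMod.baseChange S M.mod).δ m.1, fun σ => by
        rw [X.actOn_δ, ρ.point_δ, m.2 σ]⟩
      map_zero' := Subtype.ext (map_zero _)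
      map_add' := fun x y => Subtype.ext (map_add _ x.1 y.1) }
  leibniz r m := Subtype.ext (by
    have := (DMod.baseChange S M.mod).leibniz (algebraMap R S r) m.1
    rw [deriv_algebraMap, algebraMap_smul, algebraMap_smul, algebraMap_smul] at this
    exact this)

/-- The `Φ`-structure `s` on the fixed submodule is the one induced by the `Φ_S`-structure of
`M_S`: scalar multiplication `t ⊗ n ↦ t n` is an isomorphism of `Φ_S`-objects onto `M_S`. -/
def IsInducedStructure (X : HopfGalois C A R S) (ρ : AutRep C S B M)
    (a : Points C A C → Points C B C) (s : PhiStruct Φ (fixedModule X ρ a)) : Prop :=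
  ∃ e : PhiObj.Iso (PhiObj.baseChange S ⟨fixedModule X ρ a, s⟩) (M.baseChange S),
    ∀ (t : S) (n : fixedSubmodule X ρ a),
      e.toEquiv (t ⊗ₜ[R] n) = t • (n : DMod.baseChange S M.mod)

theorem IsInducedStructure.isTwistedForm {X : HopfGalois C A R S} {ρ : AutRep C S B M}
    {a : Points C A C → Points C B C} {s : PhiStruct Φ (fixedModule X ρ a)}
    (h : IsInducedStructure X ρ a s) : IsTwistedForm S M ⟨fixedModule X ρ a, s⟩ :=
  let ⟨e, _⟩ := h
  ⟨e⟩

end Correspondence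

end DiffDescent

end

open DiffDescent

/-!
The theorem is an instance of descent along a Hopf-Galois extension. Write `V = M_S`, and let `A` be
the coordinate algebra of `Γ`, `B` that of `G`. Since `A` is reduced and of finite type over an
algebraically closed field, an element of `V ⊗ A` is determined by its values at the points of `Γ`
(`eq_of_forall_evalAt`); this translates statements about all `σ ∈ Γ(C)` into statements about
coactions.

All compatibilities with the operations `Φᵢ` are handled through semilinear maps: `m ↦ 1 ⊗ m`,
`g ⊗ id : M_T → M_T'` for `g : T → T'`, and `a_σ ∘ 𝛔` all intertwine the operations, and this
property can be composed, cancelled on the right along a map with generating image and on the left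
along an injective map (`Intertwines`).

*From forms to cocycles.* An isomorphism `φ : N_S ≅ M_S` extends along `s ↦ s ⊗ 1` and along the
coaction to isomorphisms over `S ⊗ A`. Their quotient is an automorphism of `M_{S ⊗ A}`, hence an
`A`-point of `G`, hence a morphism `Γ → G`; its values are `φ ∘ 𝛔 ∘ φ⁻¹ ∘ 𝛔⁻¹`
(`exists_morphism_point`).

*From cocycles to forms.* A cocycle `a`, given by `f : B → A`, yields an automorphism `α` of
`M_{S ⊗ A}` and the twisted coaction `ω = α ∘ (Δ_S ⊗ id) : V → V ⊗ A`. The cocycle condition says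
that `ω` is coassociative, and the fixed submodule `W` of `a` is the module of coinvariants of `ω`.
The map `s ⊗ v ↦ s ω(v)`, `S ⊗_R V → V ⊗ A`, is `α` composed with the Galois isomorphism, so it is
bijective. It carries the difference of the two coactions on `S ⊗_R V` to `id ⊗ Δ_A - id ⊗ 1`,
whose kernel is `V ⊗ 1`. Faithful flatness is available only for differential modules, but `W`, `V`
and `V ⊗ A` are such, so `S ⊗_R W` is the corresponding kernel in `S ⊗_R V`, and `S ⊗_R W → V` is
bijective (`bijective_liftBaseChange_subtype`, `bijective_fixedSubmodule`).

The operations of `M_S` restrict to `W`: for each differential module `Q` the `Γ(C)`-invariants of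
`Q_S` are `Q` (`HopfGalois.exists_of_actOn_eq`, from the Amitsur complex), which is applied to the
targets `W^{⊗ n₃} ⊗ H^{⊗ n₄}` (`HopfGalois.exists_phiStruct`).

*Mutual inverses.* Under `W_S ≅ M_S` the action of `𝛔` becomes `a_σ ∘ 𝛔`, so the cocycle of `W` is
`a` (`isCocycleOf_fixedIso`). Conversely the fixed submodule of the cocycle of `φ : N_S ≅ M_S` is the
image under `φ` of the invariants of `N_S`, which is a copy of `N` (`nonempty_iso_of_isCocycleOf`).
-/

noncomputable section

namespace DiffDescent

/-! ### Semilinear maps and tensor products -/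

section SemilinearTensor

variable {T T' T'' : Type u} [CommRing T] [CommRing T'] [CommRing T''] {σ : T →+* T'}
  {τ : T' →+* T''} {ρ : T →+* T''}

theorem tensorMap_comp_apply {M₁ N₁ : Type u} {M₂ N₂ M₃ N₃ : Type u}
    [AddCommGroup M₁] [AddCommGroup N₁] [AddCommGroup M₂] [AddCommGroup N₂] [AddCommGroup M₃]
    [AddCommGroup N₃] [Module T M₁] [Module T N₁] [Module T' M₂] [Module T' N₂] [Module T'' M₃]
    [Module T'' N₃] {f : M₁ →ₛₗ[σ] M₂} {g : N₁ →ₛₗ[σ] N₂} {f' : M₂ →ₛₗ[τ] M₃}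
    {g' : N₂ →ₛₗ[τ] N₃} {f'' : M₁ →ₛₗ[ρ] M₃} {g'' : N₁ →ₛₗ[ρ] N₃}
    (hf : ∀ m, f'' m = f' (f m)) (hg : ∀ n, g'' n = g' (g n)) (x : M₁ ⊗[T] N₁) :
    TensorProduct.map f'' g'' x = TensorProduct.map f' g' (TensorProduct.map f g x) := by
  induction x using TensorProduct.induction_on with
  | zero => simp only [map_zero]
  | add x y hx hy => simp only [map_add, hx, hy]
  | tmul m n => simp only [TensorProduct.map_tmul, hf, hg]

theorem span_range_tensorMap {M N : Type u} {M' N' : Type u} [AddCommGroup M] [AddCommGroup N]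
    [AddCommGroup M'] [AddCommGroup N'] [Module T M] [Module T N] [Module T' M'] [Module T' N']
    {f : M →ₛₗ[σ] M'} {g : N →ₛₗ[σ] N'} (hf : Submodule.span T' (Set.range f) = ⊤)
    (hg : Submodule.span T' (Set.range g) = ⊤) :
    Submodule.span T' (Set.range (TensorProduct.map f g)) = ⊤ := by
  refine Submodule.eq_top_iff'.2 fun x => ?_
  induction x using TensorProduct.induction_on with
  | zero => exact zero_mem _
  | add x y hx hy => exact add_mem hx hy
  | tmul m n =>
    have hm : m ∈ Submodule.span T' (Set.range f) := hf ▸ Submodule.mem_top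
    have hn : n ∈ Submodule.span T' (Set.range g) := hg ▸ Submodule.mem_top
    induction hm using Submodule.span_induction with
    | zero => rw [TensorProduct.zero_tmul]; exact zero_mem _
    | add x y _ _ hx hy => rw [TensorProduct.add_tmul]; exact add_mem hx hy
    | smul t x _ hx => rw [← TensorProduct.smul_tmul']; exact Submodule.smul_mem _ _ hx
    | mem x hx =>
      obtain ⟨m, rfl⟩ := hx
      induction hn using Submodule.span_induction with
      | zero => rw [TensorProduct.tmul_zero]; exact zero_mem _
      | add x y _ _ hx hy => rw [TensorProduct.tmul_add]; exact add_mem hx hy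
      | smul t x _ hx => rw [TensorProduct.tmul_smul]; exact Submodule.smul_mem _ _ hx
      | mem x hx =>
        obtain ⟨n, rfl⟩ := hx
        exact Submodule.subset_span ⟨m ⊗ₜ n, TensorProduct.map_tmul ..⟩

/-- Semilinear maps which agree on a generating image are equal. -/
theorem eq_of_span_range_eq_top {M : Type u} {N P : Type u} [AddCommGroup M] [AddCommGroup N]
    [AddCommGroup P] [Module T M] [Module T' N] [Module T'' P] {f : M →ₛₗ[σ] N}
    (hf : Submodule.span T' (Set.range f) = ⊤) {g h : N →ₛₗ[τ] P}
    (H : ∀ m, g (f m) = h (f m)) (x : N) : g x = h x := by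
  have hx : x ∈ Submodule.span T' (Set.range f) := hf ▸ Submodule.mem_top
  induction hx using Submodule.span_induction with
  | zero => simp only [map_zero]
  | add x y _ _ hx hy => simp only [map_add, hx, hy]
  | smul t x _ hx => simp only [map_smulₛₗ, hx]
  | mem x hx =>
    obtain ⟨m, rfl⟩ := hx
    exact H m

end SemilinearTensor

/-! ### Semilinear tensor powers and operations -/

section Semilinear

variable {T T' T'' : Type u} [CommRing T] [Differential T] [CommRing T'] [Differential T']
  [CommRing T''] [Differential T''] {σ : T →+* T'} {τ : T' →+* T''} {ρ : T →+* T''}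

/-- The tensor power `f ⊗ ⋯ ⊗ f` of a semilinear map; the zeroth power is the ring map itself. -/
def semiPow {M : DMod T} {N : DMod T'} (f : M →ₛₗ[σ] N) :
    (n : ℕ) → (DMod.tpow M n →ₛₗ[σ] DMod.tpow N n)
  | 0 =>
    { toFun := σ
      map_add' := map_add σ
      map_smul' := map_mul σ }
  | n + 1 => TensorProduct.map f (semiPow f n)

/-- The map `f^{⊗ a} ⊗ k^{⊗ b}` induced by two semilinear maps. -/
def mixMap {M K : DMod T} {N L : DMod T'} (f : M →ₛₗ[σ] N) (k : K →ₛₗ[σ] L) (a b : ℕ) :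
    DMod.tensor (DMod.tpow M a) (DMod.tpow K b) →ₛₗ[σ]
      DMod.tensor (DMod.tpow N a) (DMod.tpow L b) :=
  TensorProduct.map (semiPow f a) (semiPow k b)

theorem semiPow_comp_apply {M : DMod T} {N : DMod T'} {P : DMod T''} {f : M →ₛₗ[σ] N}
    {f' : N →ₛₗ[τ] P} {f'' : M →ₛₗ[ρ] P} (hρ : ∀ t, ρ t = τ (σ t))
    (hf : ∀ m, f'' m = f' (f m)) :
    ∀ (n : ℕ) (x : DMod.tpow M n), semiPow f'' n x = semiPow f' n (semiPow f n x)
  | 0, x => hρ x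
  | n + 1, x => tensorMap_comp_apply hf (semiPow_comp_apply hρ hf n) x

theorem mixMap_comp_apply {M K : DMod T} {N L : DMod T'} {P Q : DMod T''} {f : M →ₛₗ[σ] N}
    {f' : N →ₛₗ[τ] P} {f'' : M →ₛₗ[ρ] P} {k : K →ₛₗ[σ] L} {k' : L →ₛₗ[τ] Q} {k'' : K →ₛₗ[ρ] Q}
    (hρ : ∀ t, ρ t = τ (σ t)) (hf : ∀ m, f'' m = f' (f m)) (hk : ∀ m, k'' m = k' (k m))
    (a b : ℕ) (x : DMod.tensor (DMod.tpow M a) (DMod.tpow K b)) :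
    mixMap f'' k'' a b x = mixMap f' k' a b (mixMap f k a b x) :=
  tensorMap_comp_apply (semiPow_comp_apply hρ hf a) (semiPow_comp_apply hρ hk b) x

theorem semiPow_eq_tpowMap {M N : DMod T} (f : M →ₗ[T] N) :
    ∀ n : ℕ, semiPow f n = DMod.tpowMap f n
  | 0 => rfl
  | n + 1 => congrArg (TensorProduct.map f) (semiPow_eq_tpowMap f n)

theorem mixMap_id_right {M N K : DMod T} (f : M →ₗ[T] N) (a b : ℕ) :
    mixMap f (LinearMap.id : K →ₗ[T] K) a b =
      TensorProduct.map (DMod.tpowMap f a) LinearMap.id := by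
  rw [mixMap, semiPow_eq_tpowMap, semiPow_eq_tpowMap, DMod.tpowMap_id]

theorem span_range_semiPow {M : DMod T} {N : DMod T'} {f : M →ₛₗ[σ] N}
    (hf : Submodule.span T' (Set.range f) = ⊤) :
    ∀ n : ℕ, Submodule.span T' (Set.range (semiPow f n)) = ⊤
  | 0 => (Ideal.eq_top_iff_one _).2 (Submodule.subset_span ⟨(1 : T), map_one σ⟩)
  | n + 1 => span_range_tensorMap hf (span_range_semiPow hf n)

theorem span_range_mixMap {M K : DMod T} {N L : DMod T'} {f : M →ₛₗ[σ] N} {k : K →ₛₗ[σ] L}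
    (hf : Submodule.span T' (Set.range f) = ⊤) (hk : Submodule.span T' (Set.range k) = ⊤)
    (a b : ℕ) : Submodule.span T' (Set.range (mixMap f k a b)) = ⊤ :=
  span_range_tensorMap (span_range_semiPow hf a) (span_range_semiPow hk b)

/-- The pair of semilinear maps `f`, `k` carries the operation `op` to the operation `op'`. -/
def Intertwines {M K : DMod T} {N L : DMod T'} (f : M →ₛₗ[σ] N) (k : K →ₛₗ[σ] L) {a b c d : ℕ}
    (op : DMod.tensor (DMod.tpow M a) (DMod.tpow K b) →ₗ[T]
      DMod.tensor (DMod.tpow M c) (DMod.tpow K d))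
    (op' : DMod.tensor (DMod.tpow N a) (DMod.tpow L b) →ₗ[T']
      DMod.tensor (DMod.tpow N c) (DMod.tpow L d)) : Prop :=
  ∀ x, op' (mixMap f k a b x) = mixMap f k c d (op x)

section Composition

variable {M K : DMod T} {N L : DMod T'} {P Q : DMod T''} {f : M →ₛₗ[σ] N}
  {f' : N →ₛₗ[τ] P} {f'' : M →ₛₗ[ρ] P} {k : K →ₛₗ[σ] L} {k' : L →ₛₗ[τ] Q} {k'' : K →ₛₗ[ρ] Q}
  {a b c d : ℕ}
  {op : DMod.tensor (DMod.tpow M a) (DMod.tpow K b) →ₗ[T]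
    DMod.tensor (DMod.tpow M c) (DMod.tpow K d)}
  {op' : DMod.tensor (DMod.tpow N a) (DMod.tpow L b) →ₗ[T']
    DMod.tensor (DMod.tpow N c) (DMod.tpow L d)}
  {op'' : DMod.tensor (DMod.tpow P a) (DMod.tpow Q b) →ₗ[T'']
    DMod.tensor (DMod.tpow P c) (DMod.tpow Q d)}

theorem Intertwines.comp (h' : Intertwines f' k' op' op'') (h : Intertwines f k op op')
    (hρ : ∀ t, ρ t = τ (σ t)) (hf : ∀ m, f'' m = f' (f m)) (hk : ∀ m, k'' m = k' (k m)) :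
    Intertwines f'' k'' op op'' := fun x => by
  rw [mixMap_comp_apply hρ hf hk, mixMap_comp_apply hρ hf hk, h', h]

/-- If `f' ∘ f` and `f` intertwine the operations and the image of `f` generates, then `f'`
intertwines the operations. -/
theorem Intertwines.of_comp_right (h'' : Intertwines f'' k'' op op'') (h : Intertwines f k op op')
    (hρ : ∀ t, ρ t = τ (σ t)) (hf : ∀ m, f'' m = f' (f m)) (hk : ∀ m, k'' m = k' (k m))
    (sf : Submodule.span T' (Set.range f) = ⊤) (sk : Submodule.span T' (Set.range k) = ⊤) :
    Intertwines f' k' op' op'' :=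
  eq_of_span_range_eq_top (g := op''.comp (mixMap f' k' a b)) (h := (mixMap f' k' c d).comp op')
    (span_range_mixMap sf sk a b) fun x => by
      rw [LinearMap.comp_apply, LinearMap.comp_apply, ← mixMap_comp_apply hρ hf hk, h'', h,
        ← mixMap_comp_apply hρ hf hk]

/-- If `f' ∘ f` and `f'` intertwine the operations and `f'` is injective on the target of the
operations, then `f` intertwines the operations. -/
theorem Intertwines.of_comp_left (h'' : Intertwines f'' k'' op op'')
    (h' : Intertwines f' k' op' op'')
    (hρ : ∀ t, ρ t = τ (σ t)) (hf : ∀ m, f'' m = f' (f m)) (hk : ∀ m, k'' m = k' (k m))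
    (hinj : Function.Injective (mixMap f' k' c d)) :
    Intertwines f k op op' := fun x => hinj <| by
  rw [← h', ← mixMap_comp_apply hρ hf hk, h'', ← mixMap_comp_apply hρ hf hk]

end Composition

end Semilinear

/-! ### Extension of scalars as a semilinear map -/

section Extension

variable {R : Type u} [CommRing R] [Differential R]
variable (T : Type u) [CommRing T] [Differential T] [Algebra R T] [DifferentialAlgebra R T]
variable {T' : Type u} [CommRing T'] [Differential T'] [Algebra R T'] [DifferentialAlgebra R T']

/-- The semilinear map `m ↦ 1 ⊗ m` from a module to its extension of scalars. -/
def unitMap (M : DMod R) : M →ₛₗ[algebraMap R T] DMod.baseChange T M where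
  toFun m := 1 ⊗ₜ[R] m
  map_add' := TensorProduct.tmul_add 1
  map_smul' r m := by
    rw [← TensorProduct.smul_tmul, TensorProduct.smul_tmul', Algebra.smul_def,
      smul_eq_mul]

theorem unitMap_apply (M : DMod R) (m : M) : unitMap T M m = 1 ⊗ₜ[R] m := rfl

theorem unitMap_δ (M : DMod R) (m : M) :
    unitMap T M (M.δ m) = (DMod.baseChange T M).δ (unitMap T M m) := by
  rw [unitMap_apply, unitMap_apply, DMod.baseChange_δ_tmul]
  simp

theorem span_range_unitMap (M : DMod R) : Submodule.span T (Set.range (unitMap T M)) = ⊤ := by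
  refine Submodule.eq_top_iff'.2 fun x => ?_
  induction x using TensorProduct.induction_on with
  | zero => exact zero_mem _
  | add x y hx hy => exact add_mem hx hy
  | tmul t m =>
    have : t ⊗ₜ[R] m = t • unitMap T M m := by
      rw [unitMap_apply, TensorProduct.smul_tmul', smul_eq_mul, mul_one]
    rw [this]
    exact Submodule.smul_mem _ _ (Submodule.subset_span ⟨m, rfl⟩)

theorem baseChangePow_unitMap (M : DMod R) : ∀ (n : ℕ) (x : DMod.tpow M n),
    DMod.baseChangePow T M n (unitMap T _ x) = semiPow (unitMap T M) n x
  | 0, x => (Algebra.algebraMap_eq_smul_one (A := T) (x : R)).symm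
  | n + 1, x => by
    induction x using TensorProduct.induction_on with
    | zero => simp only [map_zero]
    | add x y hx hy => simp only [map_add, hx, hy]
    | tmul m y =>
      exact congrArg (fun z => (1 ⊗ₜ[R] m : T ⊗[R] M) ⊗ₜ[T] z) (baseChangePow_unitMap M n y)

/-- The canonical isomorphism used to define the operations on an extension of scalars carries
`1 ⊗ x` to the image of `x` under the tensor powers of the units. -/
theorem baseChangeMixed_unitMap (M K : DMod R) (a b : ℕ)
    (x : DMod.tensor (DMod.tpow M a) (DMod.tpow K b)) :
    DMod.baseChangeMixed T M K a b (unitMap T _ x) =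
      mixMap (unitMap T M) (unitMap T K) a b x := by
  induction x using TensorProduct.induction_on with
  | zero => simp only [map_zero]
  | add x y hx hy => simp only [map_add, hx, hy]
  | tmul m k =>
    exact congrArg₂ (fun y z => y ⊗ₜ[T] z) (baseChangePow_unitMap T M a m)
      (baseChangePow_unitMap T K b k)

theorem intertwines_unitMap {Φ : PhiShape R} (M : PhiObj Φ) (i : Φ.I) :
    Intertwines (unitMap T M.mod) (unitMap T Φ.K) (M.str.op i) ((M.baseChange T).str.op i) :=
  fun x => by
    rw [← baseChangeMixed_unitMap, ← baseChangeMixed_unitMap]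
    change DMod.baseChangeMixed T _ _ _ _ ((M.str.op i).baseChange T
      ((DMod.baseChangeMixed T _ _ _ _).symm (DMod.baseChangeMixed T _ _ _ _ _))) = _
    rw [LinearEquiv.symm_apply_apply]
    rfl

variable {T}

/-- The semilinear map `g ⊗ id` between extensions of scalars along a map of `R`-algebras. -/
def extMap (g : T →ₐ[R] T') (M : DMod R) :
    DMod.baseChange T M →ₛₗ[(g : T →+* T')] DMod.baseChange T' M where
  toFun := g.toLinearMap.rTensor M
  map_add' := map_add _
  map_smul' t x := by
    induction x using TensorProduct.induction_on with
    | zero => simp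
    | add x y hx hy => simp only [smul_add, map_add, hx, hy]
    | tmul s m => simp [TensorProduct.smul_tmul']

@[simp] theorem extMap_tmul (g : T →ₐ[R] T') (M : DMod R) (t : T) (m : M) :
    extMap g M (t ⊗ₜ[R] m) = g t ⊗ₜ[R] m := rfl

theorem extMap_unitMap (g : T →ₐ[R] T') (M : DMod R) (m : M) :
    unitMap T' M m = extMap g M (unitMap T M m) := by
  rw [unitMap_apply, unitMap_apply, extMap_tmul, map_one]

/-- The map `g ⊗ id` intertwines the operations because `m ↦ 1 ⊗ m` does, over `T` and over `T'`. -/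
theorem intertwines_extMap (g : T →ₐ[R] T') {Φ : PhiShape R} (M : PhiObj Φ) (i : Φ.I) :
    Intertwines (extMap g M.mod) (extMap g Φ.K) ((M.baseChange T).str.op i)
      ((M.baseChange T').str.op i) :=
  (intertwines_unitMap T' M i).of_comp_right (intertwines_unitMap T M i)
    (fun r => (g.commutes r).symm) (extMap_unitMap g _) (extMap_unitMap g _)
    (span_range_unitMap T _) (span_range_unitMap T _)

end Extension

/-! ### Morphisms as intertwining maps -/

section Homs

variable {R : Type u} [CommRing R] [Differential R] {Φ : PhiShape R}

/-- Morphisms of objects in terms of `Intertwines`, the Hopf algebra being mapped identically. -/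
theorem isHom_iff {M N : PhiObj Φ} {f : M.mod →ₗ[R] N.mod} :
    PhiObj.IsHom f ↔ DMod.IsDHom f ∧
      ∀ i : Φ.I, Intertwines f LinearMap.id (M.str.op i) (N.str.op i) := by
  refine and_congr_right fun _ => forall_congr' fun i => ?_
  rw [LinearMap.ext_iff]
  refine forall_congr' fun x => ?_
  rw [mixMap_id_right, mixMap_id_right]
  rfl

end Homs

/-! ### Extension of scalars of isomorphisms -/

section Lift

variable {R : Type u} [CommRing R] [Differential R]
variable {T : Type u} [CommRing T] [Differential T] [Algebra R T] [DifferentialAlgebra R T]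
variable {T' : Type u} [CommRing T'] [Differential T'] [Algebra R T'] [DifferentialAlgebra R T']

theorem span_range_extMap (g : T →ₐ[R] T') (M : DMod R) :
    Submodule.span T' (Set.range (extMap g M)) = ⊤ :=
  top_le_iff.1 <| (span_range_unitMap T' M).ge.trans <| Submodule.span_mono <| by
    rintro _ ⟨m, rfl⟩
    exact ⟨_, (extMap_unitMap g M m).symm⟩

theorem extMap_δ {g : T →ₐ[R] T'} (hg : ∀ t, g t′ = (g t)′) (M : DMod R)
    (x : DMod.baseChange T M) :
    extMap g M ((DMod.baseChange T M).δ x) = (DMod.baseChange T' M).δ (extMap g M x) := by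
  induction x using TensorProduct.induction_on with
  | zero => simp only [map_zero]
  | add x y hx hy => simp only [map_add, hx, hy]
  | tmul t m =>
    rw [DMod.baseChange_δ_tmul, map_add, extMap_tmul, extMap_tmul, extMap_tmul,
      DMod.baseChange_δ_tmul, hg]

theorem extMap_comp_apply {T'' : Type u} [CommRing T''] [Differential T''] [Algebra R T'']
    [DifferentialAlgebra R T''] {g : T →ₐ[R] T'} {h : T' →ₐ[R] T''} {k : T →ₐ[R] T''}
    (hk : ∀ t, k t = h (g t)) (M : DMod R) (x : DMod.baseChange T M) :
    extMap k M x = extMap h M (extMap g M x) := by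
  induction x using TensorProduct.induction_on with
  | zero => simp only [map_zero]
  | add x y hx hy => simp only [map_add, hx, hy]
  | tmul t m => rw [extMap_tmul, extMap_tmul, extMap_tmul, hk]

theorem extMap_baseChange (g : T →ₐ[R] T') {M N : DMod R} (f : M →ₗ[R] N)
    (x : DMod.baseChange T M) :
    extMap g N (f.baseChange T x) = f.baseChange T' (extMap g M x) := by
  induction x using TensorProduct.induction_on with
  | zero => simp only [map_zero]
  | add x y hx hy => simp only [map_add, hx, hy]
  | tmul t m => rfl

/-- A linear map commutes with the derivations as soon as it does so on the image of a semilinear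
map whose image generates. -/
theorem isDHom_of_span {σ : T →+* T'} {M : DMod T} {N P : DMod T'} {s : M →ₛₗ[σ] N}
    (hs : Submodule.span T' (Set.range s) = ⊤) {f : N →ₗ[T'] P}
    (H : ∀ m, f (N.δ (s m)) = P.δ (f (s m))) : DMod.IsDHom f := fun x => by
  have hx : x ∈ Submodule.span T' (Set.range s) := hs ▸ Submodule.mem_top
  induction hx using Submodule.span_induction with
  | zero => simp only [map_zero]
  | add x y _ _ hx hy => simp only [map_add, hx, hy]
  | smul t x _ hx => rw [N.leibniz, map_add, map_smul, map_smul, map_smul, P.leibniz, hx]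
  | mem x hx =>
    obtain ⟨m, rfl⟩ := hx
    exact H m

/-- The extension of scalars of a `T`-linear map `N_T → M_T` along `T → T'`, as a map
`N_{T'} → M_{T'}`. -/
def liftMap (g : T →ₐ[R] T') {N M : DMod R}
    (f : DMod.baseChange T N →ₗ[T] DMod.baseChange T M) :
    DMod.baseChange T' N →ₗ[T'] DMod.baseChange T' M :=
  LinearMap.liftBaseChange (R := R) (M := N) (N := T' ⊗[R] M) T'
    (g.toLinearMap.rTensor M ∘ₗ f.restrictScalars R ∘ₗ TensorProduct.mk R T N 1)

theorem liftMap_extMap (g : T →ₐ[R] T') {N M : DMod R}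
    (f : DMod.baseChange T N →ₗ[T] DMod.baseChange T M) (x : DMod.baseChange T N) :
    liftMap g f (extMap g N x) = extMap g M (f x) :=
  eq_of_span_range_eq_top (τ := (g : T →+* T')) (span_range_unitMap T N)
    (g := (liftMap g f).comp (extMap g N)) (h := (extMap g M).comp f) (fun n => by
      change liftMap g f (g 1 ⊗ₜ[R] n) = _
      refine (LinearMap.liftBaseChange_tmul ..).trans ?_
      rw [map_one, one_smul]
      rfl) x

/-- The extension of scalars of a `T`-linear equivalence `N_T ≃ M_T` along `T → T'`. -/
def liftEquiv (g : T →ₐ[R] T') {N M : DMod R}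
    (e : DMod.baseChange T N ≃ₗ[T] DMod.baseChange T M) :
    DMod.baseChange T' N ≃ₗ[T'] DMod.baseChange T' M :=
  LinearEquiv.ofLinearMap (liftMap g e.toLinearMap) (liftMap g e.symm.toLinearMap)
    (LinearMap.ext fun x => eq_of_span_range_eq_top (span_range_extMap g M)
      (g := liftMap g e.toLinearMap ∘ₗ liftMap g e.symm.toLinearMap) (h := LinearMap.id)
      (fun m => by
        rw [LinearMap.comp_apply, liftMap_extMap, liftMap_extMap]
        exact congrArg _ (e.apply_symm_apply m)) x)
    (LinearMap.ext fun x => eq_of_span_range_eq_top (span_range_extMap g N)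
      (g := liftMap g e.symm.toLinearMap ∘ₗ liftMap g e.toLinearMap) (h := LinearMap.id)
      (fun m => by
        rw [LinearMap.comp_apply, liftMap_extMap, liftMap_extMap]
        exact congrArg _ (e.symm_apply_apply m)) x)

/-- The extension of scalars of an isomorphism `N_T ≅ M_T` of objects along `T → T'`. -/
def PhiObj.Iso.lift {Φ : PhiShape R} {N M : PhiObj Φ}
    (φ : PhiObj.Iso (N.baseChange T) (M.baseChange T)) (g : T →ₐ[R] T')
    (hg : ∀ t, g t′ = (g t)′) : PhiObj.Iso (N.baseChange T') (M.baseChange T') where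
  toEquiv := liftEquiv g φ.toEquiv
  isHom := by
    have h := isHom_iff.1 φ.isHom
    refine isHom_iff.2 ⟨isDHom_of_span (span_range_extMap g N.mod) fun m => ?_, fun i => ?_⟩
    · change liftMap g φ.toEquiv.toLinearMap _ = (DMod.baseChange T' M.mod).δ
        (liftMap g φ.toEquiv.toLinearMap _)
      rw [← extMap_δ hg, liftMap_extMap, liftMap_extMap, ← extMap_δ hg]
      exact congrArg _ (h.1 m)
    · exact ((intertwines_extMap g M i).comp (h.2 i) (ρ := (g : T →+* T')) (fun _ => rfl)
        (f'' := (extMap g M.mod).comp φ.toEquiv.toLinearMap) (fun _ => rfl)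
        (k'' := extMap g Φ.K) (fun _ => rfl)).of_comp_right (intertwines_extMap g N i)
        (fun _ => rfl) (fun m => (liftMap_extMap g φ.toEquiv.toLinearMap m).symm) (fun _ => rfl)
        (span_range_extMap g _) (span_range_extMap g _)

theorem PhiObj.Iso.lift_extMap {Φ : PhiShape R} {N M : PhiObj Φ}
    (φ : PhiObj.Iso (N.baseChange T) (M.baseChange T)) (g : T →ₐ[R] T')
    (hg : ∀ t, g t′ = (g t)′) (x : DMod.baseChange T N.mod) :
    (φ.lift g hg).toEquiv (extMap g N.mod x) = extMap g M.mod (φ.toEquiv x) :=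
  liftMap_extMap g φ.toEquiv.toLinearMap x

theorem PhiObj.Iso.lift_symm_extMap {Φ : PhiShape R} {N M : PhiObj Φ}
    (φ : PhiObj.Iso (N.baseChange T) (M.baseChange T)) (g : T →ₐ[R] T')
    (hg : ∀ t, g t′ = (g t)′) (x : DMod.baseChange T M.mod) :
    (φ.lift g hg).toEquiv.symm (extMap g M.mod x) = extMap g N.mod (φ.toEquiv.symm x) := by
  rw [LinearEquiv.symm_apply_eq, PhiObj.Iso.lift_extMap, LinearEquiv.apply_symm_apply]

end Lift

/-! ### Differential faithful flatness -/

section FaithfullyFlat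

variable {R : Type u} [CommRing R] [Differential R]
variable {S : Type u} [CommRing S] [Differential S] [Algebra R S] [DifferentialAlgebra R S]

theorem IsDiffFaithfullyFlat.injective_iff (hS : IsDiffFaithfullyFlat R S) {M N : DMod R}
    {f : M →ₗ[R] N} (hf : DMod.IsDHom f) :
    Function.Injective f ↔ Function.Injective (f.baseChange S) := by
  have h := hS M M N 0 f (fun m => (map_zero M.δ).symm) hf
  rw [LinearMap.baseChange_zero] at h
  exact (LinearMap.exact_zero_iff_injective _ f).symm.trans
    (h.trans (LinearMap.exact_zero_iff_injective _ (f.baseChange S)))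

variable (S) in
/-- The extension of scalars of `M`, regarded as a differential module over `R`. -/
@[reducible] def restrictedExt (M : DMod R) : DMod R := DMod.tensor (DMod.ofAlgebra S) M

variable (S) in
/-- The map `m ↦ 1 ⊗ m` as an `R`-linear map. -/
def unitLinear (M : DMod R) : M →ₗ[R] restrictedExt S M := TensorProduct.mk R S M 1

theorem isDHom_unitLinear (M : DMod R) : DMod.IsDHom (unitLinear S M) := unitMap_δ S M

/-- The unit `M → M_S` is injective: after extension of scalars it has the multiplication of `S`
as a retraction. -/
theorem IsDiffFaithfullyFlat.unitLinear_injective (hS : IsDiffFaithfullyFlat R S) (M : DMod R) :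
    Function.Injective (unitLinear S M) := by
  rw [hS.injective_iff (isDHom_unitLinear M)]
  refine Function.LeftInverse.injective
    (g := LinearMap.liftBaseChange (R := R) (M := S ⊗[R] M) (N := S ⊗[R] M) S LinearMap.id)
    fun x => ?_
  induction x using TensorProduct.induction_on with
  | zero => simp only [map_zero]
  | add x y hx hy => simp only [map_add, hx, hy]
  | tmul t m =>
    rw [LinearMap.baseChange_tmul, LinearMap.liftBaseChange_tmul]
    change t • ((1 : S) ⊗ₜ[R] m) = _
    rw [TensorProduct.smul_tmul', smul_eq_mul, mul_one]

theorem IsDiffFaithfullyFlat.mixMap_unitMap_injective (hS : IsDiffFaithfullyFlat R S)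
    (M K : DMod R) (a b : ℕ) :
    Function.Injective (mixMap (unitMap S M) (unitMap S K) a b) := fun x y h => by
  rw [← baseChangeMixed_unitMap, ← baseChangeMixed_unitMap] at h
  exact hS.unitLinear_injective _ ((DMod.baseChangeMixed S M K a b).injective h)

/-- The first step of the Amitsur complex of `S/R` with coefficients in `M` is exact: it becomes
contractible after extension of scalars to `S`. -/
theorem IsDiffFaithfullyFlat.exact_amitsur (hS : IsDiffFaithfullyFlat R S) (M : DMod R) :
    Function.Exact (unitLinear S M)
      (unitLinear S (restrictedExt S M) - (unitLinear S M).lTensor S) := by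
  have hu : DMod.IsDHom (M := restrictedExt S M) (N := restrictedExt S (restrictedExt S M))
      ((unitLinear S M).lTensor S) :=
    DMod.isDHom_tensorMap (M := DMod.ofAlgebra S) (M' := DMod.ofAlgebra S) (f := LinearMap.id)
      (fun _ => rfl) (isDHom_unitLinear M)
  refine (hS M (restrictedExt S M) (restrictedExt S (restrictedExt S M)) _ _
    (isDHom_unitLinear M) fun x => ?_).2 fun x => ⟨fun hx => ?_, ?_⟩
  · rw [LinearMap.sub_apply, LinearMap.sub_apply, map_sub, isDHom_unitLinear, hu]
  · -- Multiplication of the first two factors contracts the complex.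
    have key : ∀ x : S ⊗[R] (S ⊗[R] M),
        LinearMap.liftBaseChange (R := R) (M := S ⊗[R] (S ⊗[R] M)) (N := S ⊗[R] (S ⊗[R] M)) S
          LinearMap.id ((unitLinear S (restrictedExt S M) -
            (unitLinear S M).lTensor S).baseChange S x) =
          x - (unitLinear S M).baseChange S
            (LinearMap.liftBaseChange (R := R) (M := S ⊗[R] M) (N := S ⊗[R] M) S LinearMap.id x) :=
      fun x => by
        induction x using TensorProduct.induction_on with
        | zero => simp only [map_zero, sub_zero]
        | add x y hx hy => simp only [map_add, hx, hy]; abel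
        | tmul t y =>
          induction y using TensorProduct.induction_on with
          | zero => simp only [TensorProduct.tmul_zero, map_zero, sub_zero]
          | add x y hx hy => simp only [TensorProduct.tmul_add, map_add, hx, hy]; abel
          | tmul s m =>
            rw [LinearMap.baseChange_tmul, LinearMap.liftBaseChange_tmul,
              LinearMap.liftBaseChange_tmul, LinearMap.sub_apply, LinearMap.lTensor_tmul]
            change t • ((1 : S) ⊗ₜ[R] (s ⊗ₜ[R] m) - s ⊗ₜ[R] ((1 : S) ⊗ₜ[R] m)) = _
            rw [LinearMap.id_apply, TensorProduct.smul_tmul', LinearMap.baseChange_tmul, smul_sub,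
              TensorProduct.smul_tmul', TensorProduct.smul_tmul', smul_eq_mul, mul_one]
            rfl
    have := key x
    rw [hx, map_zero, eq_comm, sub_eq_zero] at this
    exact ⟨_, this.symm⟩
  · rintro ⟨y, rfl⟩
    induction y using TensorProduct.induction_on with
    | zero => simp only [map_zero]
    | add x y hx hy => simp only [map_add, hx, hy, add_zero]
    | tmul t m =>
      rw [LinearMap.baseChange_tmul, LinearMap.baseChange_tmul]
      have : (unitLinear S (restrictedExt S M) - (unitLinear S M).lTensor S)
          (unitLinear S M m) = 0 :=
        sub_self ((1 : S) ⊗ₜ[R] ((1 : S) ⊗ₜ[R] m))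
      rw [this, TensorProduct.tmul_zero]

/-- A map between objects over `R` is a morphism if its extension of scalars to `S` is one. -/
theorem IsDiffFaithfullyFlat.isHom_of_baseChange (hS : IsDiffFaithfullyFlat R S) {Φ : PhiShape R}
    {M N : PhiObj Φ} {f : M.mod →ₗ[R] N.mod}
    {g : DMod.baseChange S M.mod →ₗ[S] DMod.baseChange S N.mod}
    (hg : PhiObj.IsHom (M := M.baseChange S) (N := N.baseChange S) g)
    (hfg : ∀ m : M.mod, g (1 ⊗ₜ[R] m) = 1 ⊗ₜ[R] f m) : PhiObj.IsHom f := by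
  rw [isHom_iff] at hg ⊢
  refine ⟨fun m => hS.unitLinear_injective N.mod ?_, fun i => ?_⟩
  · rw [isDHom_unitLinear]
    change 1 ⊗ₜ[R] f _ = (DMod.baseChange S N.mod).δ (1 ⊗ₜ[R] f m)
    rw [← hfg, ← hfg, ← hg.1]
    exact congrArg g (unitMap_δ S M.mod m)
  · exact ((hg.2 i).comp (intertwines_unitMap S M i) (ρ := algebraMap R S) (fun _ => rfl)
      (f'' := g.comp (unitMap S M.mod)) (fun _ => rfl) (k'' := unitMap S Φ.K)
      (fun _ => rfl)).of_comp_left (intertwines_unitMap S N i) (fun _ => rfl) hfg (fun _ => rfl)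
      (hS.mixMap_unitMap_injective _ _ _ _)

end FaithfullyFlat

/-! ### Density of the points of a linear algebraic group -/

section Density

variable {C : Type u} [Field C]

/-- The Nullstellensatz: a reduced algebra of finite type over an algebraically closed field has
enough points. -/
theorem eq_zero_of_forall_algHom [IsAlgClosed C] {A : Type u} [CommRing A] [Algebra C A]
    [Algebra.FiniteType C A] [IsReduced A] {a : A} (h : ∀ σ : A →ₐ[C] C, σ a = 0) : a = 0 := by
  have hA : IsJacobsonRing A := isJacobsonRing_of_finiteType (A := C)
  have ha : a ∈ (⊥ : Ideal A).jacobson := by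
    refine Ideal.mem_sInf.2 fun m hm => ?_
    have := hm.2
    let _ : Field (A ⧸ m) := Ideal.Quotient.field m
    have : Module.Finite C (A ⧸ m) := finite_of_finite_type_of_isJacobsonRing C (A ⧸ m)
    have hb : Function.Bijective (Algebra.ofId C (A ⧸ m)) :=
      IsAlgClosed.algebraMap_bijective_of_isIntegral (k := C) (K := A ⧸ m)
    have h' := h (((AlgEquiv.ofBijective _ hb).symm : (A ⧸ m) →ₐ[C] C).comp
      (Ideal.Quotient.mkₐ C m))
    refine Ideal.Quotient.eq_zero_iff_mem.1 ((AlgEquiv.ofBijective _ hb).symm.injective ?_)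
    rw [map_zero]
    exact h'
  rwa [hA.out Ideal.isRadical_bot] at ha

/-- Evaluation `v ⊗ a ↦ σ(a) v` at a point `σ`. -/
def evalAt {A : Type u} [CommRing A] [Algebra C A] (V : Type u) [AddCommGroup V] [Module C V]
    (σ : A →ₐ[C] C) : V ⊗[C] A →ₗ[C] V :=
  (TensorProduct.rid C V).toLinearMap ∘ₗ σ.toLinearMap.lTensor V

@[simp] theorem evalAt_tmul {A : Type u} [CommRing A] [Algebra C A] (V : Type u)
    [AddCommGroup V] [Module C V] (σ : A →ₐ[C] C) (v : V) (a : A) :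
    evalAt V σ (v ⊗ₜ a) = σ a • v := rfl

/-- The elements of `V ⊗ A` are determined by their values at the points of `A`. -/
theorem eq_of_forall_evalAt [IsAlgClosed C] {A : Type u} [CommRing A] [Algebra C A]
    [Algebra.FiniteType C A] [IsReduced A] {V : Type u} [AddCommGroup V] [Module C V]
    {x y : V ⊗[C] A} (h : ∀ σ : A →ₐ[C] C, evalAt V σ x = evalAt V σ y) : x = y := by
  let b := Module.Basis.ofVectorSpace C V
  refine (TensorProduct.comm C V A).injective ((b.baseChange A).repr.injective
    (Finsupp.ext fun i => sub_eq_zero.1 (eq_zero_of_forall_algHom (C := C) fun σ => ?_)))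
  have key : ∀ x : V ⊗[C] A, σ ((b.baseChange A).repr (TensorProduct.comm C V A x) i) =
      b.repr (evalAt V σ x) i := fun x => by
    induction x using TensorProduct.induction_on with
    | zero => simp
    | add x y hx hy => simp only [map_add, Finsupp.add_apply, hx, hy]
    | tmul v a =>
      rw [TensorProduct.comm_tmul, Module.Basis.baseChange_repr_tmul]
      simp [mul_comm]
  rw [map_sub, key, key, h, sub_self]

end Density

/-! ### Descent for relative Hopf modules -/

section HopfModule

variable {C A R S V : Type u} [Field C] [CommRing A] [Bialgebra C A]
  [CommRing R] [Algebra C R] [CommRing S] [Algebra C S] [Algebra R S] [IsScalarTower C R S]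
  [AddCommGroup V] [Module C V] [Module R V] [Module S V] [IsScalarTower C R V]
  [IsScalarTower R S V] [IsScalarTower C S V]

/-- Descent for a comodule `V` with coaction `ω` for which `s ⊗ v ↦ s ω(v)` is a bijection
`S ⊗_R V → V ⊗_C A`: if extension of scalars to `S` preserves the exactness of the sequence which
defines the coinvariants `W`, then `S ⊗_R W → V` is bijective. -/
theorem bijective_liftBaseChange_subtype (ω : V →ₗ[R] V ⊗[C] A) (W : Submodule R V)
    (coassoc : ∀ v, TensorProduct.assoc C V A A ((ω.restrictScalars C).rTensor A (ω v)) =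
      (Coalgebra.comul (R := C) (A := A)).lTensor V (ω v))
    (hβ : Function.Bijective (ω.liftBaseChange S))
    (hinj : Function.Injective (W.subtype.baseChange S))
    (hW : ∀ w ∈ W, ω w = w ⊗ₜ 1)
    (hexact : ∀ z : S ⊗[R] V, ω.baseChange S z =
      ((TensorProduct.AlgebraTensorModule.mk C R V A).flip 1).baseChange S z →
      z ∈ Set.range (W.subtype.baseChange S)) :
    Function.Bijective (W.subtype.liftBaseChange S) := by
  have hone : Function.Injective fun v : V => v ⊗ₜ[C] (1 : A) := by
    refine Function.LeftInverse.injective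
      (g := TensorProduct.rid C V ∘ (Coalgebra.counit (R := C) (A := A)).lTensor V) fun v => ?_
    simp
  have hmul : ∀ y : S ⊗[R] W, ω.liftBaseChange S (W.subtype.baseChange S y) =
      W.subtype.liftBaseChange S y ⊗ₜ[C] (1 : A) := fun y => by
    induction y using TensorProduct.induction_on with
    | zero => simp
    | add x y hx hy => simp only [map_add, hx, hy, TensorProduct.add_tmul]
    | tmul s w =>
      rw [LinearMap.baseChange_tmul, LinearMap.liftBaseChange_tmul, LinearMap.liftBaseChange_tmul,
        Submodule.subtype_apply, hW w w.2, TensorProduct.smul_tmul']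
  -- The map `s ⊗ (v ⊗ a) ↦ s ω(v) ⊗ a` is bijective along with `s ⊗ v ↦ s ω(v)`.
  let βA : S ⊗[R] (V ⊗[C] A) →ₗ[C] (V ⊗[C] A) ⊗[C] A :=
    ((ω.liftBaseChange S).restrictScalars C).rTensor A ∘ₗ
      ((TensorProduct.AlgebraTensorModule.assoc C R S S V A).symm.toLinearMap.restrictScalars C)
  have hβA : Function.Injective βA :=
    ((LinearEquiv.ofBijective ((ω.liftBaseChange S).restrictScalars C) hβ).rTensor A).injective.comp
      (TensorProduct.AlgebraTensorModule.assoc C R S S V A).symm.injective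
  have hβA_tmul : ∀ (s : S) (x : V ⊗[C] A), βA (s ⊗ₜ x) =
      s • (ω.restrictScalars C).rTensor A x := fun s x => by
    induction x using TensorProduct.induction_on with
    | zero => simp
    | add x y hx hy => simp only [TensorProduct.tmul_add, map_add, hx, hy, smul_add]
    | tmul v a =>
      change (ω.liftBaseChange S (s ⊗ₜ v)) ⊗ₜ a = s • (ω v ⊗ₜ a)
      rw [LinearMap.liftBaseChange_tmul, TensorProduct.smul_tmul']
  have hω : ∀ z : S ⊗[R] V, TensorProduct.assoc C V A A (βA (ω.baseChange S z)) =
      (Coalgebra.comul (R := C) (A := A)).lTensor V (ω.liftBaseChange S z) := fun z => by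
    induction z using TensorProduct.induction_on with
    | zero => simp only [map_zero]
    | add x y hx hy => simp only [map_add, hx, hy]
    | tmul s v =>
      rw [LinearMap.baseChange_tmul, hβA_tmul, LinearMap.liftBaseChange_tmul]
      have h₁ := (TensorProduct.AlgebraTensorModule.assoc C C S V A A).map_smul s
        ((ω.restrictScalars C).rTensor A (ω v))
      have h₂ := (TensorProduct.AlgebraTensorModule.lTensor S V
        (Coalgebra.comul (R := C) (A := A))).map_smul s (ω v)
      exact h₁.trans ((congrArg (s • ·) (coassoc v)).trans h₂.symm)
  have hι : ∀ z : S ⊗[R] V,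
      βA (((TensorProduct.AlgebraTensorModule.mk C R V A).flip 1).baseChange S z) =
        ω.liftBaseChange S z ⊗ₜ[C] (1 : A) := fun z => by
    induction z using TensorProduct.induction_on with
    | zero => simp only [map_zero, TensorProduct.zero_tmul]
    | add x y hx hy => simp only [map_add, hx, hy, TensorProduct.add_tmul]
    | tmul s v => rfl
  refine ⟨fun x y hxy => hinj (hβ.1 ?_), fun v => ?_⟩
  · rw [hmul, hmul, hxy]
  · obtain ⟨z, hz⟩ := hβ.2 (v ⊗ₜ[C] (1 : A))
    obtain ⟨y, rfl⟩ := hexact z (hβA ((TensorProduct.assoc C V A A).injective (by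
      rw [hω, hι, hz, LinearMap.lTensor_tmul, TensorProduct.assoc_tmul, Bialgebra.comul_one]
      rfl)))
    rw [hmul] at hz
    exact ⟨y, hone hz⟩

end HopfModule

/-! ### Invariants of a Hopf-Galois extension -/

section Galois

variable {C A R S : Type u} [Field C] [CommRing A] [HopfAlgebra C A]
  [CommRing R] [Differential R] [Algebra C R]
  [CommRing S] [Differential S] [Algebra C S] [IsConstantAlgebra C S]
  [Algebra R S] [IsScalarTower C R S] [DifferentialAlgebra R S]

variable (R S) in
/-- Evaluation `S ⊗ A → S` at a point of the group. -/
def evalPoint (σ : Points C A C) : S ⊗[C] A →ₐ[R] S :=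
  ((Algebra.TensorProduct.rid C R S : S ⊗[C] C ≃ₐ[R] S) : S ⊗[C] C →ₐ[R] S).comp
    (Algebra.TensorProduct.map (AlgHom.id R S) σ.ofConv)

theorem evalPoint_apply (σ : Points C A C) (x : S ⊗[C] A) :
    evalPoint R S σ x = evalAt S σ.ofConv x := rfl

variable (C A R S) in
/-- The map `s ↦ s ⊗ 1`. -/
abbrev inclS : S →ₐ[R] S ⊗[C] A := Algebra.TensorProduct.includeLeft

theorem evalPoint_inclS (σ : Points C A C) (s : S) : evalPoint R S σ (inclS C A R S s) = s := by
  rw [evalPoint_apply, Algebra.TensorProduct.includeLeft_apply, evalAt_tmul, map_one, one_smul]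

theorem inclS_deriv (s : S) : inclS C A R S s′ = (inclS C A R S s)′ := rfl

theorem HopfGalois.act_eq (X : HopfGalois C A R S) (σ : Points C A C) (s : S) :
    X.act σ s = evalPoint R S σ (X.coact s) := rfl

variable (C A S) in
/-- The isomorphism `(S ⊗ A) ⊗ M ≃ (S ⊗ M) ⊗ A`. -/
def extComm (M : DMod R) :
    DMod.baseChange (S ⊗[C] A) M ≃ₗ[S] (S ⊗[R] M) ⊗[C] A :=
  TensorProduct.AlgebraTensorModule.rightComm R C S S A M

theorem evalAt_extComm (σ : Points C A C) (M : DMod R) (x : DMod.baseChange (S ⊗[C] A) M) :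
    evalAt (S ⊗[R] M) σ.ofConv (extComm C A S M x) = extMap (evalPoint R S σ) M x := by
  induction x using TensorProduct.induction_on with
  | zero => simp only [map_zero]
  | add x y hx hy => simp only [map_add, hx, hy]
  | tmul t m =>
    induction t using TensorProduct.induction_on with
    | zero => simp only [map_zero, TensorProduct.zero_tmul]
    | add x y hx hy => simp only [map_add, TensorProduct.add_tmul, hx, hy]
    | tmul s a => rfl

theorem eq_of_forall_evalPoint [IsAlgClosed C] [IsLinearAlgebraicGroup C A] {M : DMod R}
    {x y : DMod.baseChange (S ⊗[C] A) M}
    (h : ∀ σ : Points C A C, extMap (evalPoint R S σ) M x = extMap (evalPoint R S σ) M y) :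
    x = y := by
  have := IsLinearAlgebraicGroup.finiteType (C := C) (A := A)
  have := IsLinearAlgebraicGroup.reduced (C := C) (A := A)
  refine (extComm C A S M).injective (eq_of_forall_evalAt fun σ => ?_)
  have := h (WithConv.toConv σ)
  rwa [← evalAt_extComm, ← evalAt_extComm] at this

theorem HopfGalois.actOn_eq (X : HopfGalois C A R S) (σ : Points C A C) (M : DMod R)
    (x : DMod.baseChange S M) :
    X.actOn σ M x = extMap (evalPoint R S σ) M (extMap X.coact M x) :=
  extMap_comp_apply (k := X.act σ) (fun _ => rfl) M x

theorem extMap_evalPoint_inclS (σ : Points C A C) (M : DMod R) (x : DMod.baseChange S M) :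
    extMap (evalPoint R S σ) M (extMap (inclS C A R S) M x) = x := by
  rw [← extMap_comp_apply (k := AlgHom.id R S) (fun s => (evalPoint_inclS σ s).symm)]
  exact congrFun (congrArg DFunLike.coe (LinearMap.rTensor_id M S)) x

/-- The isomorphism `S ⊗ S ≃ S ⊗ A` of a Hopf-Galois extension. -/
def HopfGalois.can (X : HopfGalois C A R S) : S ⊗[R] S →ₐ[R] S ⊗[C] A :=
  Algebra.TensorProduct.productMap (Algebra.TensorProduct.includeLeft : S →ₐ[R] S ⊗[C] A) X.coact

/-- The isomorphism `S ⊗ (S ⊗ M) ≃ (S ⊗ A) ⊗ M` induced by the one of a Hopf-Galois extension. -/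
def HopfGalois.canExt (X : HopfGalois C A R S) (M : DMod R) :
    S ⊗[R] (S ⊗[R] M) ≃ₗ[R] (S ⊗[C] A) ⊗[R] M :=
  (TensorProduct.assoc R S S M).symm.trans
    ((LinearEquiv.ofBijective X.can.toLinearMap X.can_bijective).rTensor M)

theorem HopfGalois.canExt_tmul (X : HopfGalois C A R S) (M : DMod R) (s : S) (x : S ⊗[R] M) :
    X.canExt M (s ⊗ₜ x) = (s ⊗ₜ[C] (1 : A)) • extMap X.coact M x := by
  induction x using TensorProduct.induction_on with
  | zero => simp only [map_zero, TensorProduct.tmul_zero, smul_zero]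
  | add x y hx hy => simp only [map_add, TensorProduct.tmul_add, smul_add, hx, hy]
  | tmul t m =>
    rw [extMap_tmul, TensorProduct.smul_tmul', smul_eq_mul]
    rfl

/-- The coinvariants of `M_S` are the elements of `M`. -/
theorem HopfGalois.exists_of_coact_eq (X : HopfGalois C A R S) {M : DMod R}
    {x : DMod.baseChange S M} (h : extMap X.coact M x = extMap (inclS C A R S) M x) :
    ∃ m : M, 1 ⊗ₜ[R] m = x := by
  refine (X.faithfullyFlat.exact_amitsur M x).1 (sub_eq_zero.2 ((X.canExt M).injective ?_))
  refine (X.canExt_tmul M 1 x).trans ?_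
  have h₂ : X.canExt M ((unitLinear S M).lTensor S x) = extMap (inclS C A R S) M x := by
    clear h
    induction x using TensorProduct.induction_on with
    | zero => simp only [map_zero]
    | add x y hx hy => simp only [map_add, hx, hy]
    | tmul s m =>
      rw [LinearMap.lTensor_tmul]
      refine (X.canExt_tmul M s _).trans ?_
      change _ • extMap X.coact M (1 ⊗ₜ m) = _
      rw [extMap_tmul, map_one, TensorProduct.smul_tmul', smul_eq_mul, mul_one]
      rfl
  rw [h₂, h]
  exact one_smul _ _

/-- The `Γ(C)`-invariants of `M_S` are the elements of `M`. -/
theorem HopfGalois.exists_of_actOn_eq [IsAlgClosed C] [IsLinearAlgebraicGroup C A]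
    (X : HopfGalois C A R S) {M : DMod R} {x : DMod.baseChange S M}
    (h : ∀ σ, X.actOn σ M x = x) : ∃ m : M, 1 ⊗ₜ[R] m = x :=
  X.exists_of_coact_eq (eq_of_forall_evalPoint fun σ => by
    rw [← X.actOn_eq, h, extMap_evalPoint_inclS])

end Galois

/-! ### Isomorphisms of objects -/

section Isos

variable {R : Type u} [CommRing R] [Differential R] {Φ : PhiShape R}

/-- The identity isomorphism. -/
def PhiObj.Iso.refl (M : PhiObj Φ) : PhiObj.Iso M M := ⟨LinearEquiv.refl R _, PhiObj.isHom_id M⟩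

/-- The inverse isomorphism. -/
def PhiObj.Iso.symm {M N : PhiObj Φ} (e : PhiObj.Iso M N) : PhiObj.Iso N M :=
  ⟨e.toEquiv.symm, PhiObj.isHom_symm e.isHom⟩

/-- The composition of isomorphisms. -/
def PhiObj.Iso.trans {M N P : PhiObj Φ} (e : PhiObj.Iso M N) (f : PhiObj.Iso N P) :
    PhiObj.Iso M P :=
  ⟨e.toEquiv.trans f.toEquiv, PhiObj.isHom_comp f.isHom e.isHom⟩

/-- The extension of scalars of an isomorphism. -/
def PhiObj.Iso.baseChange (S : Type u) [CommRing S] [Differential S] [Algebra R S]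
    [DifferentialAlgebra R S] {M N : PhiObj Φ} (e : PhiObj.Iso M N) :
    PhiObj.Iso (M.baseChange S) (N.baseChange S) where
  toEquiv := e.toEquiv.baseChange R S _ _
  isHom := by
    have h := isHom_iff.1 e.isHom
    exact isHom_iff.2 ⟨DMod.isDHom_baseChange S h.1, fun i =>
      ((intertwines_unitMap S N i).comp (h.2 i) (ρ := algebraMap R S) (fun _ => rfl)
        (f'' := (unitMap S N.mod).comp e.toEquiv.toLinearMap) (fun _ => rfl)
        (k'' := unitMap S Φ.K) (fun _ => rfl)).of_comp_right (intertwines_unitMap S M i)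
        (fun _ => rfl) (fun _ => rfl) (fun _ => rfl)
        (span_range_unitMap S _) (span_range_unitMap S _)⟩

end Isos

/-! ### The action of the group on the automorphisms -/

section Points

variable {C : Type u} [Field C]

theorem evalAt_rTensor {A : Type u} [CommRing A] [Algebra C A] {V W : Type u} [AddCommGroup V]
    [Module C V] [AddCommGroup W] [Module C W] (f : V →ₗ[C] W) (σ : A →ₐ[C] C) (x : V ⊗[C] A) :
    evalAt W σ (f.rTensor A x) = f (evalAt V σ x) := by
  induction x using TensorProduct.induction_on with
  | zero => simp only [map_zero]
  | add x y hx hy => simp only [map_add, hx, hy]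
  | tmul v a => rw [LinearMap.rTensor_tmul, evalAt_tmul, evalAt_tmul, map_smul]

/-- The product of two points is their composite with the comultiplication, so evaluation at `σ * τ`
is an iterated evaluation. -/
theorem evalAt_mul {A : Type u} [CommRing A] [HopfAlgebra C A] {V : Type u} [AddCommGroup V]
    [Module C V] (σ τ : Points C A C) (x : V ⊗[C] A) :
    evalAt V (σ * τ).ofConv x = evalAt V σ.ofConv (evalAt (V ⊗[C] A) τ.ofConv
      ((TensorProduct.assoc C V A A).symm ((Coalgebra.comul (R := C) (A := A)).lTensor V x))) := by
  induction x using TensorProduct.induction_on with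
  | zero => simp only [map_zero]
  | add x y hx hy => simp only [map_add, hx, hy]
  | tmul v a =>
    rw [LinearMap.lTensor_tmul, evalAt_tmul]
    have h : ∀ c : A ⊗[C] A, Algebra.TensorProduct.lmul' C
        (Algebra.TensorProduct.map σ.ofConv τ.ofConv c) • v =
        evalAt V σ.ofConv (evalAt (V ⊗[C] A) τ.ofConv
          ((TensorProduct.assoc C V A A).symm (v ⊗ₜ c))) := fun c => by
      induction c using TensorProduct.induction_on with
      | zero => simp only [map_zero, zero_smul, TensorProduct.tmul_zero]
      | add x y hx hy => simp only [map_add, add_smul, TensorProduct.tmul_add, hx, hy]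
      | tmul b c =>
        rw [TensorProduct.assoc_symm_tmul, evalAt_tmul, map_smul, evalAt_tmul, smul_smul,
          Algebra.TensorProduct.map_tmul, Algebra.TensorProduct.lmul'_apply_tmul, mul_comm]
    exact h _

variable {A R S : Type u} [CommRing A] [HopfAlgebra C A]
  [CommRing R] [Differential R] [Algebra C R]
  [CommRing S] [Differential S] [Algebra C S] [IsConstantAlgebra C S]
  [Algebra R S] [IsScalarTower C R S] [DifferentialAlgebra R S]

theorem HopfGalois.act_mul (X : HopfGalois C A R S) (σ τ : Points C A C) (s : S) :
    X.act (σ * τ) s = X.act σ (X.act τ s) := by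
  rw [X.act_eq, X.act_eq, X.act_eq, evalPoint_apply, evalPoint_apply, evalPoint_apply, evalAt_mul,
    ← X.coassoc, LinearEquiv.symm_apply_apply, evalAt_rTensor]
  rfl

theorem HopfGalois.act_one (X : HopfGalois C A R S) (s : S) : X.act 1 s = s := by
  have h : X.act 1 s = TensorProduct.rid C S
      ((Coalgebra.counit (R := C) (A := A)).lTensor S (X.coact s)) := rfl
  rw [h, X.counit, TensorProduct.rid_tmul, one_smul]

theorem HopfGalois.actOn_mul (X : HopfGalois C A R S) (σ τ : Points C A C) (M : DMod R)
    (x : DMod.baseChange S M) : X.actOn (σ * τ) M x = X.actOn σ M (X.actOn τ M x) :=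
  extMap_comp_apply (g := X.act τ) (h := X.act σ) (X.act_mul σ τ) M x

theorem HopfGalois.actOn_one (X : HopfGalois C A R S) (M : DMod R)
    (x : DMod.baseChange S M) : X.actOn 1 M x = x := by
  have h : X.act 1 = AlgHom.id R S := AlgHom.ext X.act_one
  rw [HopfGalois.actOn, h]
  exact congrFun (congrArg DFunLike.coe (LinearMap.rTensor_id M S)) x

theorem HopfGalois.actOn_inv_actOn (X : HopfGalois C A R S) (σ : Points C A C) (M : DMod R)
    (x : DMod.baseChange S M) : X.actOn σ⁻¹ M (X.actOn σ M x) = x := by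
  rw [← X.actOn_mul, inv_mul_cancel, X.actOn_one]

theorem HopfGalois.actOn_actOn_inv (X : HopfGalois C A R S) (σ : Points C A C) (M : DMod R)
    (x : DMod.baseChange S M) : X.actOn σ M (X.actOn σ⁻¹ M x) = x := by
  rw [← X.actOn_mul, mul_inv_cancel, X.actOn_one]

variable {B : Type u} [CommRing B] [HopfAlgebra C B] {Φ : PhiShape R} {M : PhiObj Φ}

variable (C R S) in
/-- The isomorphism `S ⊗_C C → S`. -/
abbrev ridS : S ⊗[C] C →ₐ[R] S := (Algebra.TensorProduct.rid C R S : S ⊗[C] C ≃ₐ[R] S)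

theorem ridS_deriv (t : S ⊗[C] C) : ridS C R S t′ = (ridS C R S t)′ := by
  induction t using TensorProduct.induction_on with
  | zero => simp only [map_zero]
  | add x y hx hy => simp only [map_add, hx, hy]
  | tmul s c => exact ((derivLinear C S).map_smul c s).symm

theorem AutRep.point_scalarRid (ρ : AutRep C S B M) (x : Points C B C)
    (m : DMod.baseChange (S ⊗[C] C) M.mod) :
    ρ.point x (scalarRid C S M.mod m) = scalarRid C S M.mod ((ρ.iso C x).1 m) := by
  change scalarRid C S M.mod ((ρ.iso C x).1 ((scalarRid C S M.mod).symm _)) = _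
  rw [LinearEquiv.symm_apply_apply]

/-- The automorphism of `M_S` given by a point, as an isomorphism of objects. -/
def AutRep.pointIso (ρ : AutRep C S B M) (x : Points C B C) :
    PhiObj.Iso (M.baseChange S) (M.baseChange S) :=
  PhiObj.Iso.lift ⟨(ρ.iso C x).1, (ρ.iso C x).2⟩ (ridS C R S) ridS_deriv

theorem AutRep.pointIso_apply (ρ : AutRep C S B M) (x : Points C B C)
    (m : DMod.baseChange S M.mod) : (ρ.pointIso x).toEquiv m = ρ.point x m := by
  obtain ⟨m, rfl⟩ := (scalarRid C S M.mod).surjective m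
  rw [ρ.point_scalarRid]
  exact PhiObj.Iso.lift_extMap _ _ ridS_deriv m

/-- Every automorphism of `M_S` comes from a point of `G`. -/
theorem AutRep.exists_point (ρ : AutRep C S B M)
    (φ : PhiObj.Iso (M.baseChange S) (M.baseChange S)) :
    ∃ x : Points C B C, ∀ m, ρ.point x m = φ.toEquiv m := by
  let ψ := φ.lift (inclS C C R S) inclS_deriv
  refine ⟨(ρ.iso C).symm ⟨ψ.toEquiv, ψ.isHom⟩, fun m => ?_⟩
  have h : ∀ m, scalarRid C S M.mod (extMap (inclS C C R S) M.mod m) = m := fun m => by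
    induction m using TensorProduct.induction_on with
    | zero => simp only [map_zero]
    | add x y hx hy => simp only [map_add, hx, hy]
    | tmul s m =>
      change ((1 : C) • s) ⊗ₜ[R] m = _
      rw [one_smul]
  conv_lhs => rw [← h m]
  rw [ρ.point_scalarRid, MulEquiv.apply_symm_apply]
  refine (congrArg (scalarRid C S M.mod) (φ.lift_extMap (inclS C C R S) inclS_deriv m)).trans ?_
  exact h _

theorem AutRep.point_injective (ρ : AutRep C S B M) {x y : Points C B C}
    (h : ∀ m, ρ.point x m = ρ.point y m) : x = y := by
  refine (ρ.iso C).injective (Subtype.ext (LinearEquiv.ext fun m => ?_))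
  refine (scalarRid C S M.mod).injective ?_
  rw [← ρ.point_scalarRid, ← ρ.point_scalarRid, h]

theorem AutRep.point_mul (ρ : AutRep C S B M) (x y : Points C B C)
    (m : DMod.baseChange S M.mod) : ρ.point (x * y) m = ρ.point x (ρ.point y m) := by
  obtain ⟨m, rfl⟩ := (scalarRid C S M.mod).surjective m
  rw [ρ.point_scalarRid, ρ.point_scalarRid, ρ.point_scalarRid, map_mul]
  rfl

theorem AutRep.point_one (ρ : AutRep C S B M) (m : DMod.baseChange S M.mod) :
    ρ.point 1 m = m := by
  obtain ⟨m, rfl⟩ := (scalarRid C S M.mod).surjective m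
  rw [ρ.point_scalarRid, map_one]
  rfl

theorem AutRep.point_inv_point (ρ : AutRep C S B M) (x : Points C B C)
    (m : DMod.baseChange S M.mod) : ρ.point x⁻¹ (ρ.point x m) = m := by
  rw [← ρ.point_mul, inv_mul_cancel, ρ.point_one]

/-- The value at `σ` of the automorphism of `M_{S ⊗ A}` given by a morphism `f`. -/
theorem AutRep.point_extMap_evalPoint (ρ : AutRep C S B M) (f : B →ₐ[C] A) (σ : Points C A C)
    (y : DMod.baseChange (S ⊗[C] A) M.mod) :
    ρ.point (WithConv.toConv (σ.ofConv.comp f)) (extMap (evalPoint R S σ) M.mod y) =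
      extMap (evalPoint R S σ) M.mod ((ρ.iso A (WithConv.toConv f)).1 y) := by
  have h : ∀ y, extMap (evalPoint R S σ) M.mod y =
      scalarRid C S M.mod (scalarMap C S M.mod σ.ofConv y) :=
    extMap_comp_apply (g := Algebra.TensorProduct.map (AlgHom.id R S) σ.ofConv)
      (h := ridS C R S) (fun _ => rfl) M.mod
  rw [h, h, ρ.point_scalarRid]
  exact congrArg _ (ρ.natural A C σ.ofConv (WithConv.toConv f) y)

/-- The conjugate `𝛔 ∘ x ∘ 𝛔⁻¹` is again an automorphism of `M_S`: it is the extension of scalars of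
`x` along `𝛔 : S → S`. -/
theorem exists_conj (X : HopfGalois C A R S) (ρ : AutRep C S B M) (σ : Points C A C)
    (x : Points C B C) : ∃ y : Points C B C,
      ∀ m, ρ.point y (X.actOn σ M.mod m) = X.actOn σ M.mod (ρ.point x m) := by
  obtain ⟨y, hy⟩ := ρ.exists_point ((ρ.pointIso x).lift (X.act σ) (X.act_deriv σ))
  refine ⟨y, fun m => ?_⟩
  rw [hy, ← ρ.pointIso_apply]
  exact (ρ.pointIso x).lift_extMap (X.act σ) (X.act_deriv σ) m

/-- The point of the group `G` which corresponds to `𝛔 ∘ x ∘ 𝛔⁻¹`. -/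
def conj (X : HopfGalois C A R S) (ρ : AutRep C S B M) (σ : Points C A C)
    (x : Points C B C) : Points C B C := (exists_conj X ρ σ x).choose

theorem point_conj (X : HopfGalois C A R S) (ρ : AutRep C S B M) (σ : Points C A C)
    (x : Points C B C) (m : DMod.baseChange S M.mod) :
    ρ.point (conj X ρ σ x) (X.actOn σ M.mod m) = X.actOn σ M.mod (ρ.point x m) :=
  (exists_conj X ρ σ x).choose_spec m

theorem eq_conj (X : HopfGalois C A R S) (ρ : AutRep C S B M) {σ : Points C A C}
    {x y : Points C B C}
    (h : ∀ m, ρ.point y (X.actOn σ M.mod m) = X.actOn σ M.mod (ρ.point x m)) :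
    y = conj X ρ σ x := ρ.point_injective fun m => by
  rw [← X.actOn_actOn_inv σ M.mod m, h, point_conj]

/-- The action of `Γ(C)` on `G(C)` by conjugation. -/
def conjHom (X : HopfGalois C A R S) (ρ : AutRep C S B M) :
    Points C A C →* MulAut (Points C B C) where
  toFun σ :=
    { toFun := conj X ρ σ
      invFun := conj X ρ σ⁻¹
      left_inv := fun x => Eq.symm <| eq_conj X ρ fun m => by
        obtain ⟨m, rfl⟩ : ∃ n, X.actOn σ M.mod n = m := ⟨_, X.actOn_actOn_inv σ M.mod m⟩
        rw [X.actOn_inv_actOn, point_conj, X.actOn_inv_actOn]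
      right_inv := fun x => Eq.symm <| eq_conj X ρ fun m => by
        obtain ⟨m, rfl⟩ : ∃ n, X.actOn σ⁻¹ M.mod n = m := ⟨_, X.actOn_inv_actOn σ M.mod m⟩
        rw [X.actOn_actOn_inv, point_conj, X.actOn_actOn_inv]
      map_mul' := fun x y => Eq.symm <| eq_conj X ρ fun m => by
        rw [ρ.point_mul, ρ.point_mul, point_conj, point_conj] }
  map_one' := MulEquiv.ext fun x => Eq.symm <| eq_conj X ρ fun m => by
    rw [X.actOn_one, X.actOn_one]
    rfl
  map_mul' σ τ := MulEquiv.ext fun x => Eq.symm <| eq_conj X ρ fun m => by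
    rw [X.actOn_mul, X.actOn_mul]
    exact (point_conj X ρ σ _ _).trans (congrArg _ (point_conj X ρ τ _ _))

theorem isConjugationAction_conjHom (X : HopfGalois C A R S) (ρ : AutRep C S B M) :
    IsConjugationAction X ρ (conjHom X ρ) := fun σ x => LinearMap.ext fun m => by
  refine Eq.trans ?_ (point_conj X ρ σ x (X.actOn σ⁻¹ M.mod m))
  rw [X.actOn_actOn_inv]
  rfl

end Points

/-! ### The cocycle of a twisted form -/

section Cocycles

variable {C A B : Type u} [Field C] [CommRing A] [HopfAlgebra C A] [CommRing B] [HopfAlgebra C B]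
  {R S : Type u} [CommRing R] [Differential R] [Algebra C R]
  [CommRing S] [Differential S] [Algebra C S] [IsConstantAlgebra C S]
  [Algebra R S] [IsScalarTower C R S] [DifferentialAlgebra R S]
  {Φ : PhiShape R} {M : PhiObj Φ} {X : HopfGalois C A R S} {ρ : AutRep C S B M}
  {act : Points C A C →* MulAut (Points C B C)}

theorem IsConjugationAction.point_act (h : IsConjugationAction X ρ act) (σ : Points C A C)
    (x : Points C B C) (m : DMod.baseChange S M.mod) :
    ρ.point (act σ x) (X.actOn σ M.mod m) = X.actOn σ M.mod (ρ.point x m) := by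
  rw [h, LinearMap.comp_apply, LinearMap.comp_apply, X.actOn_inv_actOn]

theorem isCocycleOf_iff {N : PhiObj Φ} {φ : PhiObj.Iso (N.baseChange S) (M.baseChange S)}
    {a : Cocycle act} : IsCocycleOf X ρ φ a ↔ ∀ σ m, ρ.point (a.toFun σ) (X.actOn σ M.mod m) =
      φ.toEquiv (X.actOn σ N.mod (φ.toEquiv.symm m)) := by
  refine forall_congr' fun σ => ⟨fun h m => ?_, fun h m => ?_⟩
  · rw [h, X.actOn_inv_actOn]
  · rw [← h, X.actOn_actOn_inv]

theorem Cocycle.ext_toFun {a b : Cocycle act} (h : a.toFun = b.toFun) : a = b := by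
  cases a; cases b; cases h; rfl

/-- The automorphism of `M_{S ⊗ A}` which compares the extensions of `φ` along `s ↦ s ⊗ 1` and
along the coaction is a point of `G` over `A`, hence a morphism from `Γ` to `G`; its values are the
`φ ∘ 𝛔 ∘ φ⁻¹ ∘ 𝛔⁻¹`. -/
theorem exists_morphism_point (X : HopfGalois C A R S) (ρ : AutRep C S B M) {N : PhiObj Φ}
    (φ : PhiObj.Iso (N.baseChange S) (M.baseChange S)) :
    ∃ f : B →ₐ[C] A, ∀ (σ : Points C A C) (m : DMod.baseChange S M.mod),
      ρ.point (WithConv.toConv (σ.ofConv.comp f)) (X.actOn σ M.mod m) =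
        φ.toEquiv (X.actOn σ N.mod (φ.toEquiv.symm m)) := by
  let φ₀ := φ.lift (inclS C A R S) inclS_deriv
  let φ₁ := φ.lift X.coact X.coact_deriv
  let α := φ₁.symm.trans φ₀
  refine ⟨((ρ.iso A).symm ⟨α.toEquiv, α.isHom⟩).ofConv, fun σ m => ?_⟩
  rw [X.actOn_eq, ρ.point_extMap_evalPoint, WithConv.toConv_ofConv, MulEquiv.apply_symm_apply]
  have h₁ : φ₁.toEquiv.symm (extMap X.coact M.mod m) =
      extMap X.coact N.mod (φ.toEquiv.symm m) := φ.lift_symm_extMap X.coact X.coact_deriv m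
  have h₂ : ∀ y, extMap (evalPoint R S σ) M.mod (φ₀.toEquiv y) =
      φ.toEquiv (extMap (evalPoint R S σ) N.mod y) :=
    eq_of_span_range_eq_top (τ := (evalPoint R S σ : S ⊗[C] A →+* S))
      (span_range_extMap (inclS C A R S) N.mod)
      (g := (extMap (evalPoint R S σ) M.mod).comp φ₀.toEquiv.toLinearMap)
      (h := φ.toEquiv.toLinearMap.comp (extMap (evalPoint R S σ) N.mod)) fun n => by
        change extMap (evalPoint R S σ) M.mod (φ₀.toEquiv _) = φ.toEquiv _
        rw [φ.lift_extMap (inclS C A R S) inclS_deriv, extMap_evalPoint_inclS,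
          extMap_evalPoint_inclS]
  rw [X.actOn_eq, ← h₂, ← h₁]
  rfl

theorem existsUnique_isCocycleOf (hact : IsConjugationAction X ρ act) {N : PhiObj Φ}
    (φ : PhiObj.Iso (N.baseChange S) (M.baseChange S)) :
    ∃! a : Cocycle act, IsCocycleOf X ρ φ a := by
  obtain ⟨f, hf⟩ := exists_morphism_point X ρ φ
  refine ⟨⟨fun σ => WithConv.toConv (σ.ofConv.comp f), ⟨f, fun _ => rfl⟩, fun σ τ =>
    ρ.point_injective fun m => ?_⟩, isCocycleOf_iff.2 hf, fun b hb => Cocycle.ext_toFun ?_⟩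
  · rw [← X.actOn_actOn_inv (σ * τ) M.mod m, hf, X.actOn_mul, ρ.point_mul, X.actOn_mul,
      hact.point_act, hf, hf, LinearEquiv.symm_apply_apply]
  · funext σ
    refine ρ.point_injective fun m => ?_
    rw [← X.actOn_actOn_inv σ M.mod m, isCocycleOf_iff.1 hb, hf]

/-- The class of the cocycle of a twisted form depends only on the isomorphism class. -/
theorem mk_eq_mk_of_isCocycleOf (hact : IsConjugationAction X ρ act) {N N' : PhiObj Φ}
    (ψ : PhiObj.Iso N N') {φ : PhiObj.Iso (N.baseChange S) (M.baseChange S)}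
    {φ' : PhiObj.Iso (N'.baseChange S) (M.baseChange S)} {a a' : Cocycle act}
    (ha : IsCocycleOf X ρ φ a) (ha' : IsCocycleOf X ρ φ' a') : H1.mk a = H1.mk a' := by
  -- The automorphism `φ ∘ ψ⁻¹ ∘ φ'⁻¹` of `M_S` makes the cocycles equivalent.
  obtain ⟨c, hc⟩ := ρ.exists_point (φ'.symm.trans ((ψ.baseChange S).symm.trans φ))
  have hc' : ∀ n, ρ.point c (φ'.toEquiv ((ψ.baseChange S).toEquiv n)) = φ.toEquiv n := fun n => by
    rw [hc]
    change φ.toEquiv ((ψ.baseChange S).toEquiv.symm (φ'.toEquiv.symm _)) = _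
    rw [LinearEquiv.symm_apply_apply, LinearEquiv.symm_apply_apply]
  refine Quotient.sound ⟨c, fun σ => eq_mul_inv_of_mul_eq (ρ.point_injective fun m => ?_)⟩
  obtain ⟨m, rfl⟩ : ∃ n, X.actOn σ M.mod n = m := ⟨_, X.actOn_actOn_inv σ M.mod m⟩
  obtain ⟨n, rfl⟩ := φ'.toEquiv.surjective m
  obtain ⟨n, rfl⟩ := (ψ.baseChange S).toEquiv.surjective n
  have hψ : X.actOn σ N'.mod ((ψ.baseChange S).toEquiv n) =
      (ψ.baseChange S).toEquiv (X.actOn σ N.mod n) :=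
    extMap_baseChange (X.act σ) ψ.toEquiv.toLinearMap n
  rw [ρ.point_mul, ρ.point_mul, hact.point_act, hc', isCocycleOf_iff.1 ha, isCocycleOf_iff.1 ha',
    LinearEquiv.symm_apply_apply, LinearEquiv.symm_apply_apply, hψ, hc']

end Cocycles

/-! ### The fixed submodule of a cocycle -/

section Fixed

variable {C A B : Type u} [Field C] [CommRing A] [HopfAlgebra C A] [CommRing B] [HopfAlgebra C B]
  {R S : Type u} [CommRing R] [Differential R] [Algebra C R]
  [CommRing S] [Differential S] [Algebra C S] [IsConstantAlgebra C S]
  [Algebra R S] [IsScalarTower C R S] [DifferentialAlgebra R S]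
  {Φ : PhiShape R} {M : PhiObj Φ} {X : HopfGalois C A R S} {ρ : AutRep C S B M}
  {act : Points C A C →* MulAut (Points C B C)}

variable (X ρ) in
/-- The semilinear automorphism `a_σ ∘ 𝛔` of `M_S`. -/
def twist (a : Points C A C → Points C B C) (σ : Points C A C) :
    DMod.baseChange S M.mod →ₛₗ[(X.act σ : S →+* S)] DMod.baseChange S M.mod :=
  (ρ.pointIso (a σ)).toEquiv.toLinearMap.comp (extMap (X.act σ) M.mod)

theorem twist_apply (a : Points C A C → Points C B C) (σ : Points C A C)
    (m : DMod.baseChange S M.mod) :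
    twist X ρ a σ m = ρ.point (a σ) (X.actOn σ M.mod m) := ρ.pointIso_apply _ _

theorem intertwines_twist (a : Points C A C → Points C B C) (σ : Points C A C) (i : Φ.I) :
    Intertwines (twist X ρ a σ) (extMap (X.act σ) Φ.K) ((M.baseChange S).str.op i)
      ((M.baseChange S).str.op i) :=
  ((isHom_iff.1 (ρ.pointIso (a σ)).isHom).2 i).comp (intertwines_extMap (X.act σ) M i)
    (fun _ => rfl) (fun _ => rfl) (fun _ => rfl)

/-- The cocycle condition, as an action of `Γ(C)` on `M_S` by semilinear maps. -/
theorem twist_mul (hact : IsConjugationAction X ρ act) (a : Cocycle act) (σ τ : Points C A C)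
    (m : DMod.baseChange S M.mod) :
    twist X ρ a.toFun (σ * τ) m = twist X ρ a.toFun σ (twist X ρ a.toFun τ m) := by
  rw [twist_apply, twist_apply, twist_apply, a.cocycle, ρ.point_mul, X.actOn_mul, hact.point_act]

variable (X ρ) in
/-- The coaction of `A` on `M_S` twisted by a morphism `f` from `Γ` to `G`. -/
def twistCoact (f : B →ₐ[C] A) :
    DMod.baseChange S M.mod →ₗ[R] DMod.baseChange (S ⊗[C] A) M.mod :=
  (ρ.iso A (WithConv.toConv f)).1.toLinearMap.restrictScalars R ∘ₗ
    X.coact.toLinearMap.rTensor M.mod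

theorem twistCoact_apply (f : B →ₐ[C] A) (m : DMod.baseChange S M.mod) :
    twistCoact X ρ f m = (ρ.iso A (WithConv.toConv f)).1 (extMap X.coact M.mod m) := rfl

variable {a : Points C A C → Points C B C} {f : B →ₐ[C] A}

theorem extMap_twistCoact (hf : ∀ σ, a σ = WithConv.toConv (σ.ofConv.comp f)) (σ : Points C A C)
    (m : DMod.baseChange S M.mod) :
    extMap (evalPoint R S σ) M.mod (twistCoact X ρ f m) = twist X ρ a σ m := by
  rw [twist_apply, hf, X.actOn_eq, ρ.point_extMap_evalPoint, twistCoact_apply]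

/-- The fixed submodule consists of the coinvariants of the twisted coaction. -/
theorem mem_fixedSubmodule_iff [IsAlgClosed C] [IsLinearAlgebraicGroup C A]
    (hf : ∀ σ, a σ = WithConv.toConv (σ.ofConv.comp f)) {m : DMod.baseChange S M.mod} :
    m ∈ fixedSubmodule X ρ a ↔ twistCoact X ρ f m = extMap (inclS C A R S) M.mod m := by
  refine ⟨fun h => eq_of_forall_evalPoint fun σ => ?_, fun h σ => ?_⟩
  · rw [extMap_twistCoact hf, extMap_evalPoint_inclS, twist_apply]
    exact h σ
  · rw [← twist_apply, ← extMap_twistCoact hf, h, extMap_evalPoint_inclS]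

theorem twistCoact_δ (f : B →ₐ[C] A) (m : DMod.baseChange S M.mod) :
    twistCoact X ρ f ((DMod.baseChange S M.mod).δ m) =
      (DMod.baseChange (S ⊗[C] A) M.mod).δ (twistCoact X ρ f m) := by
  rw [twistCoact_apply, twistCoact_apply, extMap_δ X.coact_deriv]
  exact (ρ.iso A (WithConv.toConv f)).2.1 _

/-- The inclusion of the fixed submodule remains injective, and remains the kernel of the difference
of the twisted and the trivial coaction, after extension of scalars to `S`. -/
theorem exact_fixedSubmodule [IsAlgClosed C] [IsLinearAlgebraicGroup C A]
    (hf : ∀ σ, a σ = WithConv.toConv (σ.ofConv.comp f)) :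
    Function.Injective ((fixedSubmodule X ρ a).subtype.baseChange S) ∧
      Function.Exact ((fixedSubmodule X ρ a).subtype.baseChange S)
        ((twistCoact X ρ f - (inclS C A R S).toLinearMap.rTensor M.mod).baseChange S) := by
  have hsub : DMod.IsDHom (M := fixedModule X ρ a) (N := restrictedExt S M.mod)
      (fixedSubmodule X ρ a).subtype := fun _ => rfl
  have hdiff : DMod.IsDHom (M := restrictedExt S M.mod) (N := restrictedExt (S ⊗[C] A) M.mod)
      (twistCoact X ρ f - (inclS C A R S).toLinearMap.rTensor M.mod) := fun m => by
    rw [LinearMap.sub_apply, LinearMap.sub_apply, map_sub]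
    exact congrArg₂ (· - ·) (twistCoact_δ f m) (extMap_δ inclS_deriv M.mod m)
  refine ⟨(X.faithfullyFlat.injective_iff hsub).1 Subtype.val_injective,
    (X.faithfullyFlat _ _ _ _ _ hsub hdiff).1 fun m => ?_⟩
  rw [LinearMap.sub_apply, sub_eq_zero]
  refine (mem_fixedSubmodule_iff hf).symm.trans ⟨fun h => ⟨⟨m, h⟩, rfl⟩, ?_⟩
  rintro ⟨m, rfl⟩
  exact m.2

theorem bijective_fixedSubmodule [IsAlgClosed C] [IsLinearAlgebraicGroup C A]
    (hact : IsConjugationAction X ρ act) (a : Cocycle act) :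
    Function.Bijective ((fixedSubmodule X ρ a.toFun).subtype.liftBaseChange S) := by
  obtain ⟨f, hf⟩ := a.morphism
  have := IsLinearAlgebraicGroup.finiteType (C := C) (A := A)
  have := IsLinearAlgebraicGroup.reduced (C := C) (A := A)
  obtain ⟨hinj, hex⟩ := exact_fixedSubmodule (X := X) (ρ := ρ) hf
  let ω : S ⊗[R] M.mod →ₗ[R] (S ⊗[R] M.mod) ⊗[C] A :=
    (extComm C A S M.mod).toLinearMap.restrictScalars R ∘ₗ twistCoact X ρ f
  have hω : ∀ m, ω m = extComm C A S M.mod (twistCoact X ρ f m) := fun _ => rfl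
  have hι : ∀ m : S ⊗[R] M.mod,
      extComm C A S M.mod (extMap (inclS C A R S) M.mod m) = m ⊗ₜ[C] (1 : A) := fun m => by
    induction m using TensorProduct.induction_on with
    | zero => simp only [map_zero, TensorProduct.zero_tmul]
    | add x y hx hy => simp only [map_add, TensorProduct.add_tmul, hx, hy]
    | tmul s m => rfl
  have hev : ∀ (σ : Points C A C) m, evalAt (S ⊗[R] M.mod) σ.ofConv (ω m) =
      twist X ρ a.toFun σ m := fun σ m => by
    rw [hω, evalAt_extComm, extMap_twistCoact hf]
  refine bijective_liftBaseChange_subtype (C := C) (A := A) ω (fixedSubmodule X ρ a.toFun)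
    (fun v => ?_) ?_ hinj (fun w hw => ?_) fun z hz => ?_
  · -- Coassociativity may be checked at the points, where it is the cocycle condition.
    refine (TensorProduct.assoc C _ A A).symm.injective (eq_of_forall_evalAt fun τ =>
      eq_of_forall_evalAt fun σ => ?_)
    have := twist_mul hact a (WithConv.toConv σ) (WithConv.toConv τ) v
    rw [← hev, ← hev, ← hev, evalAt_mul] at this
    rw [LinearEquiv.symm_apply_apply, evalAt_rTensor]
    exact this.symm
  · -- The map `s ⊗ v ↦ s ω(v)` is the Galois isomorphism followed by the automorphism given by `f`.
    have h : ∀ z, ω.liftBaseChange S z = extComm C A S M.mod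
        ((ρ.iso A (WithConv.toConv f)).1 (X.canExt M.mod z)) := fun z => by
      induction z using TensorProduct.induction_on with
      | zero => simp only [map_zero]
      | add x y hx hy => simp only [map_add, hx, hy]
      | tmul s m =>
        rw [LinearMap.liftBaseChange_tmul, X.canExt_tmul, map_smul, hω, twistCoact_apply,
          ← map_smul]
        refine congrArg _ ?_
        exact (algebraMap_smul (S ⊗[C] A) s _).symm
    have h' : ⇑(ω.liftBaseChange S) = extComm C A S M.mod ∘
        (ρ.iso A (WithConv.toConv f)).1 ∘ X.canExt M.mod := funext h
    rw [h']
    exact (extComm C A S M.mod).bijective.comp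
      ((ρ.iso A (WithConv.toConv f)).1.bijective.comp (X.canExt M.mod).bijective)
  · rw [hω, (mem_fixedSubmodule_iff hf).1 hw, hι]
  · refine (hex z).1 ?_
    let e := ((extComm C A S M.mod).restrictScalars R).baseChange R S _ _
    refine e.injective ?_
    have h₁ : ∀ z, e ((twistCoact X ρ f).baseChange S z) = ω.baseChange S z := fun z => by
      induction z using TensorProduct.induction_on with
      | zero => simp only [map_zero]
      | add x y hx hy => simp only [map_add, hx, hy]
      | tmul s m => rfl
    have h₂ : ∀ z, e (((inclS C A R S).toLinearMap.rTensor M.mod).baseChange S z) =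
        ((TensorProduct.AlgebraTensorModule.mk C R (S ⊗[R] M.mod) A).flip 1).baseChange S z := fun z => by
      induction z using TensorProduct.induction_on with
      | zero => simp only [map_zero]
      | add x y hx hy => simp only [map_add, hx, hy]
      | tmul s m => exact congrArg (s ⊗ₜ[R] ·) (hι m)
    rw [LinearMap.baseChange_sub, LinearMap.sub_apply, map_sub, h₁, h₂, hz, sub_self, map_zero]

end Fixed

/-! ### Descent of operations -/

section Structure

theorem isDHom_tpowMap {R : Type u} [CommRing R] [Differential R] {M N : DMod R} {f : M →ₗ[R] N}
    (hf : DMod.IsDHom f) : ∀ n : ℕ, DMod.IsDHom (DMod.tpowMap f n)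
  | 0 => fun _ => rfl
  | n + 1 => DMod.isDHom_tensorMap hf (isDHom_tpowMap hf n)

/-- The equivalence `e^{⊗ a} ⊗ id`. -/
def mixEquiv {R : Type u} [CommRing R] [Differential R] {M N : DMod R} (K : DMod R)
    (e : M ≃ₗ[R] N) (a b : ℕ) : DMod.tensor (DMod.tpow M a) (DMod.tpow K b) ≃ₗ[R]
      DMod.tensor (DMod.tpow N a) (DMod.tpow K b) :=
  LinearEquiv.ofLinearMap (mixMap e.toLinearMap (LinearMap.id : K →ₗ[R] K) a b)
    (mixMap e.symm.toLinearMap (LinearMap.id : K →ₗ[R] K) a b)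
    (LinearMap.ext fun x => by
      rw [LinearMap.comp_apply, ← mixMap_comp_apply (f'' := LinearMap.id) (k'' := LinearMap.id)
        (fun _ => rfl) (fun m => (e.apply_symm_apply m).symm) (fun _ => rfl), mixMap_id_right,
        DMod.tpowMap_id, TensorProduct.map_id])
    (LinearMap.ext fun x => by
      rw [LinearMap.comp_apply, ← mixMap_comp_apply (f'' := LinearMap.id) (k'' := LinearMap.id)
        (fun _ => rfl) (fun m => (e.symm_apply_apply m).symm) (fun _ => rfl), mixMap_id_right,
        DMod.tpowMap_id, TensorProduct.map_id])

theorem isDHom_mixEquiv {R : Type u} [CommRing R] [Differential R] {M N : DMod R} (K : DMod R)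
    {e : M ≃ₗ[R] N} (he : DMod.IsDHom e.toLinearMap) (a b : ℕ) :
    DMod.IsDHom (mixEquiv K e a b).toLinearMap := by
  have h : (mixEquiv K e a b).toLinearMap =
      TensorProduct.map (DMod.tpowMap e.toLinearMap a) LinearMap.id := mixMap_id_right _ a b
  rw [h]
  exact DMod.isDHom_tensorMap (isDHom_tpowMap he a) fun _ => rfl

variable {R S : Type u} [CommRing R] [Differential R] [CommRing S] [Differential S] [Algebra R S]
  [DifferentialAlgebra R S] {Φ : PhiShape R} {M : PhiObj Φ} {G : DMod R}

/-- The semilinear map `n ↦ e(1 ⊗ n)` from `G` to `M_S` given by a map `e : G_S → M_S`. -/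
def formMap (e : DMod.baseChange S G ≃ₗ[S] DMod.baseChange S M.mod) :
    G →ₛₗ[algebraMap R S] DMod.baseChange S M.mod :=
  e.toLinearMap.comp (unitMap S G)

variable (Φ) in
/-- The isomorphism `S ⊗ (G^{⊗ a} ⊗ H^{⊗ b}) ≃ M_S^{⊗ a} ⊗ H_S^{⊗ b}` induced by `G_S ≃ M_S`. -/
def formEquiv (e : DMod.baseChange S G ≃ₗ[S] DMod.baseChange S M.mod) (a b : ℕ) :
    DMod.baseChange S (DMod.tensor (DMod.tpow G a) (DMod.tpow Φ.K b)) ≃ₗ[S]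
      DMod.tensor (DMod.tpow (DMod.baseChange S M.mod) a)
        (DMod.tpow (DMod.baseChange S Φ.K) b) :=
  (DMod.baseChangeMixed S G Φ.K a b).trans (mixEquiv (DMod.baseChange S Φ.K) e a b)

theorem formEquiv_unitMap (e : DMod.baseChange S G ≃ₗ[S] DMod.baseChange S M.mod) (a b : ℕ)
    (x : DMod.tensor (DMod.tpow G a) (DMod.tpow Φ.K b)) :
    formEquiv Φ e a b (unitMap S _ x) = mixMap (formMap e) (unitMap S Φ.K) a b x := by
  rw [formEquiv, LinearEquiv.trans_apply, baseChangeMixed_unitMap]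
  exact (mixMap_comp_apply (fun _ => rfl) (fun _ => rfl) (fun _ => rfl) a b x).symm

theorem isDHom_formEquiv {e : DMod.baseChange S G ≃ₗ[S] DMod.baseChange S M.mod}
    (he : DMod.IsDHom e.toLinearMap) (a b : ℕ) :
    DMod.IsDHom (formEquiv Φ e a b).toLinearMap :=
  DMod.isDHom_comp (isDHom_mixEquiv _ he a b) (DMod.isDHom_baseChangeMixed S _ _ a b)

theorem mixMap_formMap_δ {e : DMod.baseChange S G ≃ₗ[S] DMod.baseChange S M.mod}
    (he : DMod.IsDHom e.toLinearMap) (a b : ℕ)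
    (x : DMod.tensor (DMod.tpow G a) (DMod.tpow Φ.K b)) :
    mixMap (formMap e) (unitMap S Φ.K) a b ((DMod.tensor (DMod.tpow G a) (DMod.tpow Φ.K b)).δ x) =
      (DMod.tensor (DMod.tpow (DMod.baseChange S M.mod) a)
        (DMod.tpow (DMod.baseChange S Φ.K) b)).δ
        (mixMap (formMap e) (unitMap S Φ.K) a b x) := by
  rw [← formEquiv_unitMap, ← formEquiv_unitMap, unitMap_δ]
  exact isDHom_formEquiv he a b _

theorem IsDiffFaithfullyFlat.mixMap_formMap_injective (hS : IsDiffFaithfullyFlat R S)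
    (e : DMod.baseChange S G ≃ₗ[S] DMod.baseChange S M.mod) (a b : ℕ) :
    Function.Injective (mixMap (formMap e) (unitMap S Φ.K) a b) := fun x y h => by
  rw [← formEquiv_unitMap, ← formEquiv_unitMap] at h
  exact hS.unitLinear_injective _ ((formEquiv Φ e a b).injective h)

theorem intertwines_formMap {s : PhiStruct Φ G}
    {e : DMod.baseChange S G ≃ₗ[S] DMod.baseChange S M.mod}
    (h : PhiObj.IsHom (M := PhiObj.baseChange S ⟨G, s⟩) (N := M.baseChange S) e.toLinearMap)
    (i : Φ.I) : Intertwines (formMap e) (unitMap S Φ.K) (s.op i) ((M.baseChange S).str.op i) :=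
  ((isHom_iff.1 h).2 i).comp (intertwines_unitMap S ⟨G, s⟩ i) (fun _ => rfl) (fun _ => rfl)
    (fun _ => rfl)

theorem PhiStruct.ext_op {s t : PhiStruct Φ G} (h : s.op = t.op) : s = t := by
  cases s; cases t; cases h; rfl

/-- A `Φ`-structure on `G` is determined by the one of its extension of scalars. -/
theorem IsDiffFaithfullyFlat.phiStruct_eq (hS : IsDiffFaithfullyFlat R S) {s t : PhiStruct Φ G}
    {e : DMod.baseChange S G ≃ₗ[S] DMod.baseChange S M.mod}
    (hs : PhiObj.IsHom (M := PhiObj.baseChange S ⟨G, s⟩) (N := M.baseChange S) e.toLinearMap)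
    (ht : PhiObj.IsHom (M := PhiObj.baseChange S ⟨G, t⟩) (N := M.baseChange S) e.toLinearMap) :
    s = t := PhiStruct.ext_op <| funext fun i => LinearMap.ext fun x =>
  hS.mixMap_formMap_injective e _ _ <| by
    rw [← intertwines_formMap hs i, ← intertwines_formMap ht i]

/-- Descent of `Φ`-structures along a Hopf-Galois extension: given `e : G_S ≃ M_S`, semilinear
automorphisms of `M_S` which respect the operations of `M_S` and fix the image of `G`, the
operations of `M_S` restrict to operations on `G`. -/
theorem HopfGalois.exists_phiStruct {C A : Type u} [Field C] [IsAlgClosed C] [CommRing A]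
    [HopfAlgebra C A] [IsLinearAlgebraicGroup C A] [Algebra C R] [Algebra C S]
    [IsConstantAlgebra C S] [IsScalarTower C R S] (X : HopfGalois C A R S)
    {e : DMod.baseChange S G ≃ₗ[S] DMod.baseChange S M.mod} (he : DMod.IsDHom e.toLinearMap)
    {t : ∀ σ : Points C A C,
      DMod.baseChange S M.mod →ₛₗ[(X.act σ : S →+* S)] DMod.baseChange S M.mod}
    (ht : ∀ σ i, Intertwines (t σ) (extMap (X.act σ) Φ.K) ((M.baseChange S).str.op i)
      ((M.baseChange S).str.op i))
    (hfix : ∀ σ n, t σ (formMap e n) = formMap e n) :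
    ∃ s : PhiStruct Φ G,
      PhiObj.IsHom (M := PhiObj.baseChange S ⟨G, s⟩) (N := M.baseChange S) e.toLinearMap := by
  have hfixed : ∀ σ a b (x : DMod.tensor (DMod.tpow G a) (DMod.tpow Φ.K b)),
      mixMap (t σ) (extMap (X.act σ) Φ.K) a b (mixMap (formMap e) (unitMap S Φ.K) a b x) =
        mixMap (formMap e) (unitMap S Φ.K) a b x := fun σ a b x =>
    (mixMap_comp_apply (fun r => ((X.act σ).commutes r).symm) (fun n => (hfix σ n).symm)
      (extMap_unitMap (X.act σ) Φ.K) a b x).symm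
  have hequiv : ∀ σ a b (x : DMod.baseChange S (DMod.tensor (DMod.tpow G a) (DMod.tpow Φ.K b))),
      mixMap (t σ) (extMap (X.act σ) Φ.K) a b (formEquiv Φ e a b x) =
        formEquiv Φ e a b (X.actOn σ _ x) := fun σ a b =>
    eq_of_span_range_eq_top (τ := (X.act σ : S →+* S)) (span_range_unitMap S _)
      (g := (mixMap (t σ) (extMap (X.act σ) Φ.K) a b).comp (formEquiv Φ e a b).toLinearMap)
      (h := (formEquiv Φ e a b).toLinearMap.comp (extMap (X.act σ) _)) fun x => by
        rw [LinearMap.comp_apply, LinearMap.comp_apply, ← extMap_unitMap]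
        simp only [LinearEquiv.coe_coe]
        rw [formEquiv_unitMap, hfixed]
  -- The value of an operation on `G` is invariant under `𝛔`, hence lies in the target over `R`.
  have hop : ∀ (i : Φ.I) (x : Φ.src G i), ∃ y : Φ.tgt G i,
      mixMap (formMap e) (unitMap S Φ.K) (Φ.n₃ i) (Φ.n₄ i) y = (M.baseChange S).str.op i
        (mixMap (formMap e) (unitMap S Φ.K) (Φ.n₁ i) (Φ.n₂ i) x) := fun i x => by
    obtain ⟨z, hz⟩ := (formEquiv Φ e (Φ.n₃ i) (Φ.n₄ i)).surjective ((M.baseChange S).str.op i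
      (mixMap (formMap e) (unitMap S Φ.K) (Φ.n₁ i) (Φ.n₂ i) x))
    obtain ⟨y, rfl⟩ := X.exists_of_actOn_eq (x := z) fun σ =>
      (formEquiv Φ e (Φ.n₃ i) (Φ.n₄ i)).injective <| by
        rw [← hequiv, hz, ← ht, hfixed]
    exact ⟨y, by rw [← hz, ← formEquiv_unitMap]; rfl⟩
  choose op hop using hop
  have hinj := fun i => X.faithfullyFlat.mixMap_formMap_injective (Φ := Φ) e (Φ.n₃ i) (Φ.n₄ i)
  let s : PhiStruct Φ G :=
    { op := fun i =>
        { toFun := op i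
          map_add' := fun x y => hinj i <| by simp only [map_add, hop]
          map_smul' := fun r x => hinj i <| by
            simp only [map_smulₛₗ, hop, RingHom.id_apply] }
      op_δ := fun i x => hinj i <| by
        refine (hop i _).trans ?_
        rw [mixMap_formMap_δ he, mixMap_formMap_δ he]
        refine ((M.baseChange S).str.op_δ i _).trans ?_
        rw [← hop]
        rfl }
  refine ⟨s, isHom_iff.2 ⟨he, fun i => ?_⟩⟩
  have h : Intertwines (formMap e) (unitMap S Φ.K) (s.op i) ((M.baseChange S).str.op i) :=
    fun x => (hop i x).symm
  exact h.of_comp_right (intertwines_unitMap S ⟨G, s⟩ i) (fun _ => rfl) (fun _ => rfl)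
    (fun _ => rfl) (span_range_unitMap S _) (span_range_unitMap S _)

end Structure

/-! ### The twisted form of a cocycle -/

section FixedStructure

variable {C A B : Type u} [Field C] [IsAlgClosed C] [CommRing A] [HopfAlgebra C A]
  [IsLinearAlgebraicGroup C A] [CommRing B] [HopfAlgebra C B]
  {R S : Type u} [CommRing R] [Differential R] [Algebra C R]
  [CommRing S] [Differential S] [Algebra C S] [IsConstantAlgebra C S]
  [Algebra R S] [IsScalarTower C R S] [DifferentialAlgebra R S]
  {Φ : PhiShape R} {M : PhiObj Φ} {X : HopfGalois C A R S} {ρ : AutRep C S B M}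
  {act : Points C A C →* MulAut (Points C B C)}

/-- Scalar multiplication as an isomorphism from the extension of scalars of the fixed submodule
to `M_S`. -/
def fixedEquiv (hact : IsConjugationAction X ρ act) (a : Cocycle act) :
    DMod.baseChange S (fixedModule X ρ a.toFun) ≃ₗ[S] DMod.baseChange S M.mod :=
  LinearEquiv.ofBijective ((fixedSubmodule X ρ a.toFun).subtype.liftBaseChange S)
    (bijective_fixedSubmodule hact a)

theorem fixedEquiv_tmul (hact : IsConjugationAction X ρ act) (a : Cocycle act) (t : S)
    (n : fixedSubmodule X ρ a.toFun) :
    fixedEquiv hact a (t ⊗ₜ[R] n) = t • (n : DMod.baseChange S M.mod) :=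
  LinearMap.liftBaseChange_tmul ..

theorem fixedEquiv_unitMap (hact : IsConjugationAction X ρ act) (a : Cocycle act)
    (n : fixedModule X ρ a.toFun) :
    fixedEquiv hact a (unitMap S (fixedModule X ρ a.toFun) n) = n.1 :=
  (fixedEquiv_tmul hact a 1 n).trans (one_smul S _)

theorem isDHom_fixedEquiv (hact : IsConjugationAction X ρ act) (a : Cocycle act) :
    DMod.IsDHom (fixedEquiv hact a).toLinearMap :=
  isDHom_of_span (span_range_unitMap S _) fun n => by
    rw [← unitMap_δ]
    simp only [LinearEquiv.coe_coe]
    rw [fixedEquiv_unitMap, fixedEquiv_unitMap]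
    rfl

theorem isInducedStructure_iff (hact : IsConjugationAction X ρ act) (a : Cocycle act)
    {s : PhiStruct Φ (fixedModule X ρ a.toFun)} : IsInducedStructure X ρ a.toFun s ↔
      PhiObj.IsHom (M := PhiObj.baseChange S ⟨fixedModule X ρ a.toFun, s⟩) (N := M.baseChange S)
        (fixedEquiv hact a).toLinearMap := by
  refine ⟨fun ⟨e, he⟩ => ?_, fun h => ⟨⟨fixedEquiv hact a, h⟩, fixedEquiv_tmul hact a⟩⟩
  have h : fixedEquiv hact a = e.toEquiv := LinearEquiv.ext fun x => by
    induction x using TensorProduct.induction_on with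
    | zero => simp only [map_zero]
    | add x y hx hy => simp only [map_add, hx, hy]
    | tmul t n => exact (fixedEquiv_tmul hact a t n).trans (he t n).symm
  rw [h]
  exact e.isHom

theorem existsUnique_isInducedStructure (hact : IsConjugationAction X ρ act) (a : Cocycle act) :
    ∃! s : PhiStruct Φ (fixedModule X ρ a.toFun), IsInducedStructure X ρ a.toFun s := by
  simp only [isInducedStructure_iff hact a]
  obtain ⟨s, hs⟩ := X.exists_phiStruct (isDHom_fixedEquiv hact a)
    (intertwines_twist (X := X) (ρ := ρ) a.toFun) fun σ n => by
      have h : formMap (fixedEquiv hact a) n = n.1 := fixedEquiv_unitMap hact a n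
      rw [h, twist_apply]
      exact n.2 σ
  exact ⟨s, hs, fun t ht => X.faithfullyFlat.phiStruct_eq ht hs⟩

/-- The isomorphism from the extension of scalars of the fixed submodule to `M_S`. -/
def fixedIso (hact : IsConjugationAction X ρ act) (a : Cocycle act)
    {s : PhiStruct Φ (fixedModule X ρ a.toFun)} (hs : IsInducedStructure X ρ a.toFun s) :
    PhiObj.Iso (PhiObj.baseChange S ⟨fixedModule X ρ a.toFun, s⟩) (M.baseChange S) :=
  ⟨fixedEquiv hact a, (isInducedStructure_iff hact a).1 hs⟩

/-- The cocycle of the fixed submodule of `a` is `a`: both `a_σ ∘ 𝛔` and the transport of `𝛔` are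
`𝛔`-semilinear and fix the generating set of fixed elements. -/
theorem isCocycleOf_fixedIso (hact : IsConjugationAction X ρ act) (a : Cocycle act)
    {s : PhiStruct Φ (fixedModule X ρ a.toFun)} (hs : IsInducedStructure X ρ a.toFun s) :
    IsCocycleOf X ρ (fixedIso hact a hs) a := by
  refine isCocycleOf_iff.2 fun σ m => ?_
  obtain ⟨x, rfl⟩ := (fixedIso hact a hs).toEquiv.surjective m
  rw [LinearEquiv.symm_apply_apply, ← twist_apply]
  refine eq_of_span_range_eq_top (τ := (X.act σ : S →+* S)) (span_range_unitMap S _)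
    (g := (twist X ρ a.toFun σ).comp (fixedEquiv hact a).toLinearMap)
    (h := (fixedEquiv hact a).toLinearMap.comp (extMap (X.act σ) _)) (fun n => ?_) x
  rw [LinearMap.comp_apply, LinearMap.comp_apply, ← extMap_unitMap]
  simp only [LinearEquiv.coe_coe]
  rw [fixedEquiv_unitMap, twist_apply]
  exact n.2 σ

/-- Objects whose extensions of scalars to `S` are identified with `M_S` are isomorphic if an
automorphism of `M_S` carries one to the other. -/
theorem nonempty_iso_of_forms (hS : IsDiffFaithfullyFlat R S) {N N' : PhiObj Φ}
    (φ : PhiObj.Iso (N.baseChange S) (M.baseChange S))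
    (φ' : PhiObj.Iso (N'.baseChange S) (M.baseChange S)) (f : N.mod ≃ₗ[R] N'.mod)
    (c : PhiObj.Iso (M.baseChange S) (M.baseChange S))
    (h : ∀ n, φ'.toEquiv (1 ⊗ₜ[R] f n) = c.toEquiv (φ.toEquiv (1 ⊗ₜ[R] n))) :
    Nonempty (PhiObj.Iso N N') :=
  ⟨⟨f, hS.isHom_of_baseChange ((φ.trans c).trans φ'.symm).isHom fun n =>
    (LinearEquiv.symm_apply_eq _).2 (h n).symm⟩⟩

/-- Equivalent cocycles have isomorphic fixed submodules. -/
theorem nonempty_iso_fixedModule (hact : IsConjugationAction X ρ act) {a b : Cocycle act}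
    (hab : cocycleSetoid act a b) {s : PhiStruct Φ (fixedModule X ρ a.toFun)}
    {t : PhiStruct Φ (fixedModule X ρ b.toFun)} (hs : IsInducedStructure X ρ a.toFun s)
    (ht : IsInducedStructure X ρ b.toFun t) :
    Nonempty (PhiObj.Iso (⟨_, s⟩ : PhiObj Φ) ⟨_, t⟩) := by
  -- Multiplication by `c` maps the fixed submodule of `b` to that of `c b σ(c)⁻¹`.
  have hmap : ∀ {a b : Cocycle act} {c : Points C B C},
      (∀ σ, a.toFun σ = c * b.toFun σ * (act σ c)⁻¹) → ∀ m ∈ fixedSubmodule X ρ b.toFun,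
        ρ.point c m ∈ fixedSubmodule X ρ a.toFun := fun {a b c} h m hm σ => by
    rw [← hact.point_act, ← ρ.point_mul, h, inv_mul_cancel_right, ρ.point_mul, hm σ]
  obtain ⟨c, hc⟩ := (cocycleSetoid act).symm hab
  have hc' : ∀ σ, a.toFun σ = c⁻¹ * b.toFun σ * (act σ c⁻¹)⁻¹ := fun σ => by
    rw [hc, map_inv]
    simp [mul_assoc]
  let f : fixedModule X ρ a.toFun ≃ₗ[R] fixedModule X ρ b.toFun :=
    LinearEquiv.ofLinearMap ((ρ.point c).restrict (hmap hc)) ((ρ.point c⁻¹).restrict (hmap hc'))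
      (LinearMap.ext fun m => Subtype.ext (by
        change ρ.point c (ρ.point c⁻¹ m.1) = m.1
        rw [← ρ.point_mul, mul_inv_cancel, ρ.point_one]))
      (LinearMap.ext fun m => Subtype.ext (ρ.point_inv_point c m.1))
  refine nonempty_iso_of_forms X.faithfullyFlat (fixedIso hact a hs) (fixedIso hact b ht) f
    (ρ.pointIso c) fun n => ?_
  refine (fixedEquiv_unitMap hact b (f n)).trans ?_
  refine (Eq.trans ?_ (ρ.pointIso_apply c _).symm)
  exact congrArg (ρ.point c) (fixedEquiv_unitMap hact a n).symm

/-- A twisted form is recovered as the fixed submodule of its cocycle. -/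
theorem nonempty_iso_of_isCocycleOf (hact : IsConjugationAction X ρ act) {N : PhiObj Φ}
    {φ : PhiObj.Iso (N.baseChange S) (M.baseChange S)} {a : Cocycle act}
    (ha : IsCocycleOf X ρ φ a) {s : PhiStruct Φ (fixedModule X ρ a.toFun)}
    (hs : IsInducedStructure X ρ a.toFun s) :
    Nonempty (PhiObj.Iso N ⟨_, s⟩) := by
  have hmem : ∀ n : N.mod, φ.toEquiv (1 ⊗ₜ[R] n) ∈ fixedSubmodule X ρ a.toFun := fun n σ => by
    rw [isCocycleOf_iff.1 ha, LinearEquiv.symm_apply_apply]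
    exact congrArg _ (extMap_unitMap (X.act σ) N.mod n).symm
  let f : N.mod →ₗ[R] fixedModule X ρ a.toFun :=
    ((φ.toEquiv.toLinearMap.restrictScalars R) ∘ₗ unitLinear S N.mod).codRestrict _ hmem
  have hf : Function.Bijective f := by
    refine ⟨fun x y h => X.faithfullyFlat.unitLinear_injective N.mod
      (φ.toEquiv.injective (congrArg Subtype.val h)), fun m => ?_⟩
    obtain ⟨n, hn⟩ := X.exists_of_actOn_eq (x := φ.toEquiv.symm m.1) fun σ => by
      rw [LinearEquiv.eq_symm_apply, ← isCocycleOf_iff.1 ha]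
      exact m.2 σ
    exact ⟨n, Subtype.ext ((congrArg φ.toEquiv hn).trans (φ.toEquiv.apply_symm_apply _))⟩
  exact nonempty_iso_of_forms X.faithfullyFlat φ (fixedIso hact a hs) (LinearEquiv.ofBijective f hf)
    (PhiObj.Iso.refl _) fun n => fixedEquiv_unitMap hact a (f n)

end FixedStructure

end DiffDescent

end

theorem mainTheorem3
    {C : Type u} [Field C] [IsAlgClosed C] [CharZero C]
    {A : Type u} [CommRing A] [HopfAlgebra C A] [IsLinearAlgebraicGroup C A]
    {B : Type u} [CommRing B] [HopfAlgebra C B] [IsLinearAlgebraicGroup C B]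
    {R : Type u} [CommRing R] [Differential R] [Algebra C R] [IsConstantAlgebra C R]
    {S : Type u} [CommRing S] [Differential S] [Algebra C S] [IsConstantAlgebra C S]
    [Algebra R S] [IsScalarTower C R S] [DifferentialAlgebra R S]
    (X : HopfGalois C A R S) (Φ : PhiType R) (M : PhiObj Φ.shape) (ρ : AutRep C S B M) :
    ∃ act : Points C A C →* MulAut (Points C B C), IsConjugationAction X ρ act ∧
      (∀ (N : PhiObj Φ.shape) (φ : PhiObj.Iso (N.baseChange S) (M.baseChange S)),
        ∃! a : Cocycle act, IsCocycleOf X ρ φ a) ∧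
      (∀ a : Cocycle act, ∃! s : PhiStruct Φ.shape (fixedModule X ρ a.toFun),
        IsInducedStructure X ρ a.toFun s) ∧
      ∃ (F : TF S M → H1 act) (G : H1 act → TF S M),
        (∀ (N : PhiObj Φ.shape) (φ : PhiObj.Iso (N.baseChange S) (M.baseChange S))
          (a : Cocycle act), IsCocycleOf X ρ φ a → F (TF.mk S N ⟨φ⟩) = H1.mk a) ∧
        (∀ (a : Cocycle act) (s : PhiStruct Φ.shape (fixedModule X ρ a.toFun))
          (h : IsInducedStructure X ρ a.toFun s),
          G (H1.mk a) = TF.mk S ⟨fixedModule X ρ a.toFun, s⟩ h.isTwistedForm) ∧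
        Function.LeftInverse G F ∧ Function.RightInverse G F := by
  have hact := isConjugationAction_conjHom X ρ
  refine ⟨conjHom X ρ, hact, fun N φ => existsUnique_isCocycleOf hact φ,
    existsUnique_isInducedStructure hact, ?_⟩
  choose cocycleOf hcocycleOf _ using fun (N : PhiObj Φ.shape)
    (φ : PhiObj.Iso (N.baseChange S) (M.baseChange S)) => existsUnique_isCocycleOf hact φ
  choose str hstr _ using existsUnique_isInducedStructure (X := X) (ρ := ρ) hact
  let F : TF S M → H1 (conjHom X ρ) :=
    Quotient.lift (fun N => H1.mk (cocycleOf N.1 N.2.some)) fun N N' ⟨ψ⟩ =>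
      mk_eq_mk_of_isCocycleOf hact ψ (hcocycleOf _ _) (hcocycleOf _ _)
  let G : H1 (conjHom X ρ) → TF S M :=
    Quotient.lift (fun a => TF.mk S ⟨_, str a⟩ (hstr a).isTwistedForm) fun a b hab =>
      Quotient.sound (nonempty_iso_fixedModule hact hab (hstr a) (hstr b))
  have hF : ∀ (N : PhiObj Φ.shape) (φ : PhiObj.Iso (N.baseChange S) (M.baseChange S))
      (a : Cocycle (conjHom X ρ)), IsCocycleOf X ρ φ a → F (TF.mk S N ⟨φ⟩) = H1.mk a :=
    fun N φ a ha => mk_eq_mk_of_isCocycleOf hact (PhiObj.Iso.refl N) (hcocycleOf _ _) ha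
  have hG : ∀ (a : Cocycle (conjHom X ρ)) (s : PhiStruct Φ.shape (fixedModule X ρ a.toFun))
      (h : IsInducedStructure X ρ a.toFun s),
      G (H1.mk a) = TF.mk S ⟨fixedModule X ρ a.toFun, s⟩ h.isTwistedForm := fun a s h =>
    Quotient.sound (nonempty_iso_fixedModule hact ((cocycleSetoid _).refl a) (hstr a) h)
  refine ⟨F, G, hF, hG, fun x => ?_, fun x => ?_⟩
  · obtain ⟨⟨N, ⟨φ⟩⟩, rfl⟩ := Quotient.exists_rep x
    change G (F (TF.mk S N ⟨φ⟩)) = TF.mk S N ⟨φ⟩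
    rw [hF N φ _ (hcocycleOf N φ), hG _ _ (hstr _)]
    obtain ⟨ψ⟩ := nonempty_iso_of_isCocycleOf hact (hcocycleOf N φ) (hstr _)
    exact Quotient.sound ⟨ψ.symm⟩
  · obtain ⟨a, rfl⟩ := Quotient.exists_rep x
    change F (G (H1.mk a)) = H1.mk a
    rw [hG a _ (hstr a)]
    exact hF _ (fixedIso hact a (hstr a)) a (isCocycleOf_fixedIso hact a (hstr a))
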